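/- Let $p$ be a prime, let $k$ be an arbitrary (not necessarily perfect) field of characteristic $p$, and let $E$ be a complete discretely valued field with valuation ring $\mathcal{O}_E\cong k[[t]]$, so that $E\cong k((t))$. Fix separable closures $k^{\mathrm{sep}}$ and $E^{\mathrm{sep}}$, put $G_k=\mathrm{Gal}(k^{\mathrm{sep}}/k)$ and $G_E=\mathrm{Gal}(E^{\mathrm{sep}}/E)$, and let $G_k^{\mathrm{ab}}$, $G_E^{\mathrm{ab}}$ be their abelianizations as profinite groups (quotients by the closed commutator subgroups). Let $E^{\mathrm{ab}}$ and $k^{\mathrm{ab}}$ be the maximal abelian extensions of $E$ in $E^{\mathrm{sep}}$ and of $k$ in $k^{\mathrm{sep}}$, so that $G_E^{\mathrm{ab}}=\mathrm{Gal}(E^{\mathrm{ab}}/E)$. Let $\mathcal{I}\subseteq G_E^{\mathrm{ab}}$ be the inertia subgroup of $\mathrm{Gal}(E^{\mathrm{ab}}/E)$, i.e. the subgroup of the elements acting trivially on the residue field of $E^{\mathrm{ab}}$, and let $\pi:G_E^{\mathrm{ab}}\to G_k^{\mathrm{ab}}$ be the canonical map, given by restriction of automorphisms to the image of $k^{\mathrm{ab}}$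 under any embedding $k^{\mathrm{sep}}\hookrightarrow E^{\mathrm{sep}}$ over $k$. (1) There is an isomorphism of topological groups $$\mathcal{I}\oplus G_k^{\mathrm{ab}}\;\xrightarrow{\ \sim\ }\;G_E^{\mathrm{ab}}$$ which is the inclusion on $\mathcal{I}$ and whose composite with $\pi$ is the projection onto $G_k^{\mathrm{ab}}$. (2) The group $\mathcal{I}$ has a unique pro-$p$-Sylow subgroup $\mathcal{P}$ (the wild inertia subgroup), and there is an isomorphism of topological groups $$\mathcal{P}\oplus(\mathcal{I}/\mathcal{P})\oplus G_k^{\mathrm{ab}}\;\xrightarrow{\ \sim\ }\;G_E^{\mathrm{ab}}$$ which is the inclusion on $\mathcal{P}$, sends each class in $\mathcal{I}/\mathcal{P}$ to an element of that class, and whose composite with $\pi$ is the projection onto $G_k^{\mathrm{ab}}$. -/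

import Mathlib

/-- For a Galois extension `L / K`, the abelianized Galois group of `L / K`: the quotient of
`Gal(L/K)` by the closure of its commutator subgroup, with the quotient topology.
For a separable closure `L` of `K` this is the group `G_K^ab`. -/
abbrev GaloisAb (K L : Type*) [Field K] [Field L] [Algebra K L] : Type _ :=
  TopologicalAbelianization Gal(L/K)

/-- The maximal abelian extension of `K` inside a Galois extension `L / K`: the field fixed by the
closed commutator subgroup of `Gal(L/K)`. -/
def maxAbelianExt (K L : Type*) [Field K] [Field L] [Algebra K L] : IntermediateField K L :=
  IntermediateField.fixedField (commutator Gal(L/K)).topologicalClosure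

/-- The isomorphism `Gal(L/K)^ab ≃ Gal(K^ab/K)` of Galois theory, induced by restriction of
automorphisms, where `K^ab` is the maximal abelian extension of `K` inside `L`. -/
noncomputable def galoisAbEquiv (K L : Type*) [Field K] [Field L] [Algebra K L] [IsGalois K L] :
    GaloisAb K L ≃* Gal(maxAbelianExt K L/K) :=
  InfiniteGalois.normalAutEquivQuotient
    (⟨(commutator Gal(L/K)).topologicalClosure,
      Subgroup.isClosed_topologicalClosure _⟩ : ClosedSubgroup Gal(L/K))

/-- The inertia subgroup of `Gal(F/E)`, for an algebraic extension `F` of a henselian valued field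
`E` with valuation ring `O`. The valuation ring of `F` is then the integral closure `O_F` of `O`
in `F`, its maximal ideal is the Jacobson radical of `O_F`, and the inertia subgroup consists of
the automorphisms that act trivially on `O_F` modulo the maximal ideal. -/
def inertiaGroup {E : Type*} [Field E] (O : ValuationSubring E)
    (F : Type*) [Field F] [Algebra E F] : Subgroup Gal(F/E) :=
  Ideal.inertia Gal(F/E) (Ideal.jacobson (⊥ : Ideal (integralClosure O F)))

/-- The inertia subgroup of the abelianized Galois group `Gal(L/E)^ab = Gal(E^ab/E)`: the inertia
subgroup of the extension `E^ab / E`. -/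
noncomputable def inertiaAb {E : Type*} [Field E] (O : ValuationSubring E)
    (L : Type*) [Field L] [Algebra E L] [IsGalois E L] : Subgroup (GaloisAb E L) :=
  (inertiaGroup O (maxAbelianExt E L)).comap (galoisAbEquiv E L).toMonoidHom

/-- `P` is a pro-`p`-Sylow subgroup of the closed subgroup `I` of a profinite group `G`: a closed
subgroup of `I` that is a pro-`p` group and whose index in `I` is prime to `p`. -/
structure IsProPSylow {G : Type*} [Group G] [TopologicalSpace G] (p : ℕ) (P I : Subgroup G) :
    Prop where
  le : P ≤ I
  isClosed : IsClosed (P : Set G)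
  pro_p : ∀ U : OpenSubgroup G, ∃ n : ℕ, (U : Subgroup G).relIndex P = p ^ n
  index_prime_to_p : ∀ U : OpenSubgroup G, P ≤ (U : Subgroup G) →
    ¬ p ∣ (U : Subgroup G).relIndex I

/-- `π` is the canonical map `G_E^ab → G_k^ab`, where `E` has the valuation ring `O ≃ k[[t]]`:
restriction of automorphisms of the separable closure `Es` of `E` to the maximal abelian extension
of the field of constants `k`. The map is the same for every embedding `j` over `k` of the
separable closure `ks` of `k` into `Es`. -/
def IsRestrictionToConstants {k ks E Es : Type*} [Field k] [Field ks] [Algebra k ks]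
    [Field E] [Field Es] [Algebra E Es] {O : ValuationSubring E} (e : O ≃+* PowerSeries k)
    (π : GaloisAb E Es → GaloisAb k ks) : Prop :=
  ∀ j : ks →+* Es,
    (∀ a : k, j (algebraMap k ks a) = algebraMap E Es (e.symm (PowerSeries.C a) : E)) →
    ∀ (σ : Gal(Es/E)) (τ : Gal(ks/k)),
      π (QuotientGroup.mk σ) = QuotientGroup.mk τ ↔
        ∀ x ∈ maxAbelianExt k ks, σ (j x) = j (τ x)

/-! Everything rests on a continuous section of the restriction map `r : G_E → G_k` that needs no
perfectness of `k`. Let `K` be the algebraic closure of `ks`. The Hahn series field `K((t^ℚ))` is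
algebraically closed (`HahnSeries.isAlgClosed`), so `Es` embeds into it over `E = k((t))`. An
automorphism of `ks / k` extends uniquely to `K`, because `K / ks` is purely inseparable, and then
acts on Hahn series coefficientwise. This action fixes `E` and preserves the image of the normal
extension `Es`; its restriction to `Es` is the section (`constantsLift`).

After abelianization `π` is split, and it remains to see that its kernel is inertia. Inertia fixes
`k^ab`, since a nonzero constant is a unit and so lies outside the Jacobson radical
(`restrictionHom_mem_of_mem_inertiaAb`). Conversely, a class in the kernel is represented by an
automorphism fixing all constants, after correction by the section; such an automorphism is inert
because a `p`-power of each residue comes from `ks` (`smul_sub_mem_jacobson`).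

For (2), a closed subgroup of a profinite abelian group is the product of its pro-`p` part and its
prime-to-`p` part; the latter maps isomorphically onto the quotient by the former
(`exists_proPSylow_splitting`). -/

namespace HahnSeries

/-! ### Valuations on algebraic extensions of `K((t^ℚ))`. -/

section ExtendedValuation

variable {K L Γ₀ : Type*} [Field K] [Field L] [Algebra (HahnSeries ℚ K) L]
  [LinearOrderedCommGroupWithZero Γ₀] (w : Valuation L Γ₀)

/-- The valuation `w` of an extension of the Hahn series field `K((t^ℚ))` dominates the
`t`-adic one. -/
structure DominatedBy : Prop where
  lt_one : ∀ h : HahnSeries ℚ K, 0 < h.orderTop → w (algebraMap _ L h) < 1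
  const : ∀ c : K, c ≠ 0 → w (algebraMap _ L (single (0 : ℚ) c)) = 1

/-- The value of the monomial `t^q`. -/
noncomputable def monomialValue (K : Type*) [Field K] [Algebra (HahnSeries ℚ K) L] (q : ℚ) : Γ₀ :=
  w (algebraMap _ L (single q (1 : K)))

variable {w}

theorem monomialValue_add (q r : ℚ) :
    monomialValue w K (q + r) = monomialValue w K q * monomialValue w K r := by
  simp only [monomialValue]
  rw [← map_mul, ← map_mul, single_mul_single, one_mul]

theorem monomialValue_zero : monomialValue w K 0 = 1 := by
  simp only [monomialValue]
  rw [show single (0 : ℚ) (1 : K) = 1 from rfl, map_one, map_one]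

theorem monomialValue_ne_zero (q : ℚ) : monomialValue w K q ≠ 0 := by
  simp [monomialValue]

theorem monomialValue_nsmul (q : ℚ) (n : ℕ) :
    monomialValue w K (n * q) = monomialValue w K q ^ n := by
  induction n with
  | zero => simp [monomialValue_zero]
  | succ n ih => rw [pow_succ, ← ih, ← monomialValue_add]; congr 1; push_cast; ring

theorem DominatedBy.map_single (hw : DominatedBy (K := K) w) (q : ℚ) {c : K} (hc : c ≠ 0) :
    w (algebraMap _ L (single q c)) = monomialValue w K q := by
  have : single q c = single (0 : ℚ) c * single q (1 : K) := by simp [single_mul_single]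
  rw [this, map_mul, map_mul, hw.const c hc, one_mul, monomialValue]

theorem DominatedBy.lt_of_lt_orderTop (hw : DominatedBy (K := K) w) {q : ℚ} {h : HahnSeries ℚ K}
    (hq : q < h.orderTop) : w (algebraMap _ L h) < monomialValue w K q := by
  have h1 : h = HahnSeries.single q (1 : K) * (HahnSeries.single (-q) (1 : K) * h) := by
    rw [← mul_assoc, single_mul_single]; simp
  have h2 : 0 < (HahnSeries.single (-q) (1 : K) * h).orderTop := by
    rw [← addVal_apply, AddValuation.map_mul, addVal_apply, addVal_apply,
      orderTop_single one_ne_zero]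
    rcases eq_or_ne h 0 with rfl | h0
    · simp
    · rw [← order_eq_orderTop_of_ne_zero h0] at hq ⊢
      have : q < h.order := by exact_mod_cast hq
      exact_mod_cast (by linarith : 0 < -q + h.order)
  rw [h1, map_mul, map_mul]
  exact mul_lt_of_lt_one_right (zero_lt_iff.2 (monomialValue_ne_zero q)) (hw.lt_one _ h2)

theorem lt_orderTop_sub_single (h : HahnSeries ℚ K) (q : ℚ) (hq : q ≤ h.orderTop) :
    q < (h - single q (h.coeff q)).orderTop := by
  by_contra! hlt
  obtain ⟨r, hr, hrq⟩ : ∃ r : ℚ, (h - single q (h.coeff q)).coeff r ≠ 0 ∧ r ≤ q := by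
    have hne : h - single q (h.coeff q) ≠ 0 := fun h0 => by simp [h0] at hlt
    refine ⟨_, mt coeff_order_eq_zero.1 hne, ?_⟩
    rw [← order_eq_orderTop_of_ne_zero hne] at hlt
    exact_mod_cast hlt
  rcases hrq.eq_or_lt with rfl | hrq
  · simp at hr
  · rw [coeff_sub, coeff_single_of_ne hrq.ne, sub_zero] at hr
    exact hr (coeff_eq_zero_of_lt_orderTop (lt_of_lt_of_le (WithTop.coe_lt_coe.2 hrq) hq))

/-- The tail after the leading term has strictly smaller value, so the ultrametric inequality leaves
only the leading monomial: `w` restricts to the `t`-adic valuation. -/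
theorem DominatedBy.eq_monomialValue (hw : DominatedBy (K := K) w) {h : HahnSeries ℚ K}
    (h0 : h ≠ 0) : w (algebraMap _ L h) = monomialValue w K h.order := by
  have h1 := hw.lt_of_lt_orderTop (lt_orderTop_sub_single h h.order
    (order_eq_orderTop_of_ne_zero h0).le)
  have h2 := hw.map_single h.order (c := h.coeff h.order) (by rwa [Ne, coeff_order_eq_zero])
  rw [map_sub, ← h2] at h1
  rw [← h2]
  exact Valuation.map_eq_of_sub_lt _ h1

theorem DominatedBy.strictAnti (hw : DominatedBy (K := K) w) : StrictAnti (monomialValue w K) := by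
  intro q r hqr
  exact hw.lt_of_lt_orderTop (lt_orderTop_single hqr)

theorem DominatedBy.lt_orderTop_of_lt (hw : DominatedBy (K := K) w) {q : ℚ} {h : HahnSeries ℚ K}
    (hq : w (algebraMap _ L h) < monomialValue w K q) : q < h.orderTop := by
  rcases eq_or_ne h 0 with rfl | h0
  · simp
  · rw [hw.eq_monomialValue h0, hw.strictAnti.lt_iff_gt] at hq
    rw [← order_eq_orderTop_of_ne_zero h0]
    exact_mod_cast hq

/-- The value group of `K((t^ℚ))` does not grow in algebraic extensions. -/
theorem DominatedBy.exists_eq_monomialValue [Algebra.IsAlgebraic (HahnSeries ℚ K) L]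
    (hw : DominatedBy (K := K) w) {y : L} (hy : y ≠ 0) : ∃ q : ℚ, w y = monomialValue w K q := by
  obtain ⟨p, hp0, hp⟩ := Algebra.IsAlgebraic.isAlgebraic (R := HahnSeries ℚ K) y
  have hne : p.support.Nonempty := Polynomial.support_nonempty.2 hp0
  let f : ℕ → L := fun i => algebraMap _ L (p.coeff i) * y ^ i
  have hf0 : ∀ i ∈ p.support, w (f i) ≠ 0 := fun i hi => by
    simpa [f, hy] using hi
  have hsum : ∑ i ∈ p.support, f i = 0 := by
    rw [← hp, Polynomial.aeval_def, Polynomial.eval₂_eq_sum, Polynomial.sum_def]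
  -- The terms of the relation sum to zero, so the maximal value is attained at least twice;
  -- equating two such values determines `w y`.
  obtain ⟨i, hi, hmax⟩ := p.support.exists_max_image (fun i => w (f i)) hne
  obtain ⟨j, hj, hji, hjeq⟩ : ∃ j ∈ p.support, j ≠ i ∧ w (f j) = w (f i) := by
    by_contra! hcon
    have : w (∑ i ∈ p.support, f i) = w (f i) := by
      refine Valuation.map_sum_eq_of_lt w hi fun j hj => ?_
      rw [Finset.mem_sdiff, Finset.mem_singleton] at hj
      exact lt_of_le_of_ne (hmax j hj.1) (hcon j hj.1 hj.2)
    rw [hsum, map_zero] at this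
    exact hf0 i hi this.symm
  have key : ∀ i j : ℕ, i < j → i ∈ p.support → j ∈ p.support → w (f i) = w (f j) →
      ∃ q : ℚ, w y = monomialValue w K q := by
    intro i j hij hi hj h
    have hi' := Polynomial.mem_support_iff.1 hi
    have hj' := Polynomial.mem_support_iff.1 hj
    obtain ⟨n, rfl⟩ := Nat.exists_eq_add_of_lt hij
    have hyi : w y ^ i ≠ 0 := pow_ne_zero _ (by simpa using hy)
    simp only [f, map_mul, map_pow, hw.eq_monomialValue hi', hw.eq_monomialValue hj'] at h
    rw [add_assoc, _root_.pow_add (w y), mul_comm (w y ^ i), ← mul_assoc] at h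
    have h1 := mul_right_cancel₀ hyi h
    -- A Newton polygon slope; it is an admissible exponent because the exponent group `ℚ` is
    -- divisible.
    refine ⟨((p.coeff i).order - (p.coeff (i + (n + 1))).order) / ((n + 1 : ℕ) : ℚ), ?_⟩
    have h2 : monomialValue w K (((p.coeff i).order - (p.coeff (i + (n + 1))).order) /
        ((n + 1 : ℕ) : ℚ)) ^ (n + 1) = w y ^ (n + 1) := by
      rw [← monomialValue_nsmul, mul_div_cancel₀]
      · apply mul_left_cancel₀ (monomialValue_ne_zero (w := w) (K := K) (p.coeff (i + (n + 1))).order)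
        rw [← monomialValue_add, ← h1, add_sub_cancel]
      · positivity
    exact ((pow_left_inj₀ zero_le zero_le n.succ_ne_zero).1 h2).symm
  rcases lt_or_gt_of_ne hji with h | h
  · exact key j i h hj hi hjeq
  · exact key i j h hi hj hjeq.symm

/-- The residue field of `K((t^ℚ))` does not grow in algebraic extensions if `K` is algebraically
closed. -/
theorem DominatedBy.exists_sub_lt_one [IsAlgClosed K] [Algebra.IsAlgebraic (HahnSeries ℚ K) L]
    (hw : DominatedBy (K := K) w) {u : L} (hu : w u = 1) :
    ∃ c : K, w (u - algebraMap _ L (HahnSeries.single (0 : ℚ) c)) < 1 := by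
  obtain ⟨p, hp0, hp⟩ := Algebra.IsAlgebraic.isAlgebraic (R := HahnSeries ℚ K) u
  have hne : p.support.Nonempty := Polynomial.support_nonempty.2 hp0
  obtain ⟨m, hm, hmin⟩ := p.support.exists_min_image (fun i => (p.coeff i).order) hne
  set q := (p.coeff m).order with hq
  let κ : K →+* L := (algebraMap (HahnSeries ℚ K) L).comp HahnSeries.C
  -- The reduction of `t^(-q) p`, nonzero because index `m` attains the minimal order `q`. Since `p`
  -- vanishes at `u`, `g` takes a value `< 1` there, so some linear factor of `g` must have value `<
  -- 1` at `u`.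
  let g : Polynomial K := ∑ i ∈ p.support, Polynomial.monomial i ((p.coeff i).coeff q)
  have hg0 : g ≠ 0 := by
    intro h
    have : g.coeff m = (p.coeff m).coeff q := by
      simp only [g, Polynomial.finsetSum_coeff, Polynomial.coeff_monomial]
      rw [Finset.sum_ite_eq' p.support m, if_pos hm]
    rw [h, Polynomial.coeff_zero, eq_comm, hq, coeff_order_eq_zero] at this
    exact Polynomial.mem_support_iff.1 hm this
  have hlt : w (g.eval₂ κ u) < 1 := by
    have h1 : algebraMap _ L (HahnSeries.single q (1 : K)) * g.eval₂ κ u =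
        - ∑ i ∈ p.support, algebraMap _ L
          (p.coeff i - HahnSeries.single q ((p.coeff i).coeff q)) * u ^ i := by
      have h0 : ∑ i ∈ p.support, algebraMap _ L (p.coeff i) * u ^ i = 0 := by
        rw [← hp, Polynomial.aeval_def, Polynomial.eval₂_eq_sum, Polynomial.sum_def]
      simp only [map_sub, sub_mul, Finset.sum_sub_distrib, h0, zero_sub, neg_neg, g]
      rw [Polynomial.eval₂_finsetSum, Finset.mul_sum]
      refine Finset.sum_congr rfl fun i _ => ?_
      rw [Polynomial.eval₂_monomial, ← mul_assoc, RingHom.comp_apply, ← map_mul,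
        HahnSeries.C_apply, single_mul_single, add_zero, one_mul]
    have h2 : w (algebraMap _ L (HahnSeries.single q (1 : K)) * g.eval₂ κ u) <
        monomialValue w K q := by
      rw [h1, Valuation.map_neg]
      refine Valuation.map_sum_lt _ (monomialValue_ne_zero q) fun i hi => ?_
      rw [map_mul, map_pow, hu, one_pow, mul_one]
      refine hw.lt_of_lt_orderTop (lt_orderTop_sub_single _ _ ?_)
      rw [← order_eq_orderTop_of_ne_zero (Polynomial.mem_support_iff.1 hi)]
      exact_mod_cast hmin i hi
    rw [map_mul] at h2
    by_contra! h3
    exact absurd h2 (not_lt.2 (le_mul_of_one_le_right' h3))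
  by_contra! hcon
  have hprod : ∀ s : Multiset K, 1 ≤ w ((s.map fun a => Polynomial.X - Polynomial.C a).prod.eval₂ κ u) := by
    intro s
    induction s using Multiset.induction_on with
    | empty => simp
    | cons a s ih =>
      rw [Multiset.map_cons, Multiset.prod_cons, Polynomial.eval₂_mul, map_mul]
      refine one_le_mul_of_one_le_of_one_le ?_ ih
      simpa [κ, HahnSeries.C_apply] using hcon a
  have hs := (IsAlgClosed.splits g).eq_prod_roots
  rw [hs, Polynomial.eval₂_mul, map_mul, Polynomial.eval₂_C] at hlt
  have hlc : w (κ g.leadingCoeff) = 1 := hw.const _ (Polynomial.leadingCoeff_ne_zero.2 hg0)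
  rw [hlc, one_mul] at hlt
  exact absurd hlt (not_lt.2 (hprod _))

/-- The extension is immediate: dividing `y` by a monomial of the same value reduces to the residue
field. -/
theorem DominatedBy.exists_sub_single_lt [IsAlgClosed K] [Algebra.IsAlgebraic (HahnSeries ℚ K) L]
    (hw : DominatedBy (K := K) w) {y : L} (hy : y ≠ 0) :
    ∃ (q : ℚ) (c : K), w (y - algebraMap _ L (HahnSeries.single q c)) < monomialValue w K q ∧
      w y = monomialValue w K q := by
  obtain ⟨q, hq⟩ := hw.exists_eq_monomialValue hy
  have ht : algebraMap _ L (HahnSeries.single q (1 : K)) ≠ 0 := by simp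
  obtain ⟨c, hc⟩ := hw.exists_sub_lt_one (u := y / algebraMap _ L (HahnSeries.single q (1 : K)))
    (by rw [map_div₀, hq, monomialValue, div_self (by simp)])
  refine ⟨q, c, ?_, hq⟩
  have : y - algebraMap _ L (HahnSeries.single q c) = algebraMap _ L (HahnSeries.single q (1 : K)) *
      (y / algebraMap _ L (HahnSeries.single q (1 : K)) -
        algebraMap _ L (HahnSeries.single (0 : ℚ) c)) := by
    rw [mul_sub, mul_div_cancel₀ _ ht, ← map_mul, single_mul_single]; simp
  rw [this, map_mul]
  exact mul_lt_of_lt_one_right (zero_lt_iff.2 (monomialValue_ne_zero q)) hc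

/-- The field `K((t^ℚ))` has no proper algebraic extension if `K` is algebraically closed. -/
theorem DominatedBy.algebraMap_surjective [IsAlgClosed K]
    [Algebra.IsAlgebraic (HahnSeries ℚ K) L] (hw : DominatedBy (K := K) w) :
    Function.Surjective (algebraMap (HahnSeries ℚ K) L) := by
  classical
  intro x
  by_contra! hx
  -- `S q a` says that `a` approximates `x` beyond `t^q`. Such approximations share all coefficients
  -- up to `q`, so they glue to one series `b`, with coefficient `0` where no approximation exists.
  let S : ℚ → HahnSeries ℚ K → Prop := fun q a => w (x - algebraMap _ L a) < monomialValue w K q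
  have hS : ∀ {q a b}, S q a → S q b → ∀ r ≤ q, a.coeff r = b.coeff r := by
    intro q a b ha hb r hr
    have h1 : w (algebraMap _ L (a - b)) < monomialValue w K q := by
      have := Valuation.map_sub_lt w hb ha
      rwa [sub_sub_sub_cancel_left, ← map_sub] at this
    have h2 := coeff_eq_zero_of_lt_orderTop
      (lt_of_le_of_lt (WithTop.coe_le_coe.2 hr) (hw.lt_orderTop_of_lt h1))
    rwa [coeff_sub, sub_eq_zero] at h2
  have hmono : ∀ {q r a}, S q a → r ≤ q → S r a := fun h hr =>
    lt_of_lt_of_le h (hw.strictAnti.antitone hr)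
  let f : ℚ → K := fun q => if h : ∃ a, S q a then h.choose.coeff q else 0
  have hf : ∀ {q a}, S q a → f q = a.coeff q := by
    intro q a ha
    have h : ∃ a, S q a := ⟨a, ha⟩
    simp only [f, dif_pos h]
    exact hS h.choose_spec ha q le_rfl
  -- A descending sequence in the support stays below its first exponent, where `f` agrees with a
  -- single Hahn series.
  have hwf : (Function.support f).IsPWO := by
    refine Set.IsWF.isPWO (Set.isWF_iff_no_descending_seq.2 fun u hu hmem => ?_)
    have h0 : ∃ a, S (u 0) a := by
      by_contra h
      exact hmem 0 (by simp only [f, dif_neg h])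
    obtain ⟨a, ha⟩ := h0
    refine Set.isWF_iff_no_descending_seq.1 a.isWF_support u hu fun n => ?_
    rw [mem_support, ← hf (hmono ha (hu.antitone (Nat.zero_le n)))]
    exact hmem n
  let b : HahnSeries ℚ K := ⟨f, hwf⟩
  -- Adding the leading term of `x - b` to `b` gives an approximation beyond `t^q`. Its coefficient
  -- at `q` is already that of `b`, so the leading term vanishes, a contradiction.
  obtain ⟨q, c, hc, hq⟩ := hw.exists_sub_single_lt (y := x - algebraMap _ L b)
    (sub_ne_zero.2 (hx b).symm)
  have hSq : S q (b + HahnSeries.single q c) := by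
    simpa only [S, map_add, ← sub_sub] using hc
  have h1 : b.coeff q = (b + HahnSeries.single q c).coeff q := hf hSq
  have hc0 : c = 0 := by simpa using h1
  rw [hc0] at hc
  simp [hq] at hc

end ExtendedValuation

/-- Adjoin a root of an irreducible polynomial and choose a valuation ring of the extension
dominating the `t`-adic one. Its valuation satisfies `DominatedBy`, so the extension is trivial and
the root already lies below. -/
instance isAlgClosed (K : Type*) [Field K] [IsAlgClosed K] : IsAlgClosed (HahnSeries ℚ K) := by
  refine IsAlgClosed.of_exists_root _ fun p _ hirr => ?_
  have : Fact (Irreducible p) := ⟨hirr⟩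
  let L := AdjoinRoot p
  have : FiniteDimensional (HahnSeries ℚ K) L := (AdjoinRoot.powerBasis hirr.ne_zero).finite
  let v : Valuation (HahnSeries ℚ K) _ := addVal ℚ K
  let A := v.valuationSubring
  have hA : ∀ h : HahnSeries ℚ K, h ∈ A ↔ 0 ≤ h.orderTop := fun h => Iff.rfl
  obtain ⟨V, hV, hloc⟩ :=
    IsLocalRing.exists_factor_valuationRing ((algebraMap (HahnSeries ℚ K) L).comp A.subtype)
  have hw : DominatedBy (K := K) V.valuation := by
    refine ⟨fun h hh => ?_, fun c hc => ?_⟩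
    · have hmem := (hA h).2 hh.le
      have : ¬ IsUnit (⟨h, hmem⟩ : A) := by
        intro hu
        obtain ⟨⟨g, hg⟩, hgh⟩ := hu.exists_right_inv
        have h1 : h * g = 1 := congrArg Subtype.val hgh
        have h2 : h.orderTop + g.orderTop = 0 := by
          rw [← addVal_apply, ← addVal_apply, ← AddValuation.map_mul, h1, AddValuation.map_one]
        have h3 : 0 ≤ g.orderTop := (hA g).1 hg
        exact absurd h2 (add_pos_of_pos_of_nonneg hh h3).ne'
      have h2 := mt (hloc.map_nonunit ⟨h, hmem⟩) this
      exact (V.valuation_lt_one_iff ⟨_, hV ⟨h, hmem⟩⟩).1 ((IsLocalRing.mem_maximalIdeal _).2 h2)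
    · have hmem : ∀ c : K, single (0 : ℚ) c ∈ A := fun c => (hA _).2 orderTop_single_le
      have hle : ∀ c : K, V.valuation (algebraMap _ L (single (0 : ℚ) c)) ≤ 1 := fun c =>
        (V.valuation_le_one_iff _).2 (hV ⟨_, hmem c⟩)
      refine le_antisymm (hle c) ?_
      have h1 : V.valuation (algebraMap _ L (single (0 : ℚ) c)) *
          V.valuation (algebraMap _ L (single (0 : ℚ) c⁻¹)) = 1 := by
        rw [← map_mul, ← map_mul, single_mul_single, mul_inv_cancel₀ hc, add_zero]
        exact (congrArg _ (map_one (algebraMap (HahnSeries ℚ K) L))).trans (map_one _)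
      rw [← h1]
      exact mul_le_of_le_one_right' (hle _)
  obtain ⟨x, hx⟩ := hw.algebraMap_surjective (AdjoinRoot.root p)
  refine ⟨x, (algebraMap (HahnSeries ℚ K) L).injective ?_⟩
  rw [map_zero, ← AdjoinRoot.eval₂_root p, ← Polynomial.eval₂_at_apply, hx]
  rfl

end HahnSeries

/-! ### Integral closures of complete discrete valuation rings are local. -/

section LocalIntegralClosure

/-- A finite free algebra over a ring which is complete with respect to an ideal is complete. -/
theorem IsAdicComplete.map_of_free {R B : Type*} [CommRing R] [CommRing B] [Algebra R B]
    [Module.Finite R B] [Module.Free R B] (I : Ideal R) [IsAdicComplete I R] :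
    IsAdicComplete (I.map (algebraMap R B)) B := by
  let b := Module.Free.chooseBasis R B
  have hmem : ∀ (n : ℕ) (x : B), x ∈ ((I.map (algebraMap R B)) ^ n • ⊤ : Ideal B) ↔
      ∀ i, b.repr x i ∈ I ^ n := by
    intro n x
    rw [smul_eq_mul, Ideal.mul_top, ← Ideal.map_pow]
    have hx : x ∈ (I ^ n).map (algebraMap R B) ↔ x ∈ (I ^ n • ⊤ : Submodule R B) := by
      rw [Ideal.smul_top_eq_map]; rfl
    rw [hx]
    constructor
    · intro h i
      refine Submodule.smul_induction_on h (fun r hr y _ => ?_) (fun y z hy hz => ?_)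
      · simpa using Ideal.mul_mem_right _ _ hr
      · simpa using add_mem hy hz
    · intro h
      rw [← b.sum_repr x]
      exact sum_mem fun i _ => Submodule.smul_mem_smul (h i) trivial
  refine { haus' := fun x hx => ?_, prec' := fun f hf => ?_ }
  · refine b.repr.injective (Finsupp.ext fun i => ?_)
    rw [map_zero, Finsupp.zero_apply]
    refine IsHausdorff.haus (I := I) inferInstance _ fun n => ?_
    have := (hmem n x).1 (SModEq.zero.1 (hx n)) i
    rw [SModEq.zero, smul_eq_mul, Ideal.mul_top]
    exact this
  · have hlim : ∀ i, ∃ L : R, ∀ n, b.repr (f n) i ≡ L [SMOD (I ^ n • ⊤ : Ideal R)] := by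
      intro i
      refine IsPrecomplete.prec (I := I) inferInstance fun {m n} hmn => ?_
      have := (hmem m _).1 (SModEq.sub_mem.1 (hf hmn)) i
      rw [SModEq.sub_mem, smul_eq_mul, Ideal.mul_top]
      simpa using this
    choose L hL using hlim
    refine ⟨∑ i, L i • b i, fun n => ?_⟩
    rw [SModEq.sub_mem, hmem]
    intro i
    have := SModEq.sub_mem.1 (hL i n)
    rw [smul_eq_mul, Ideal.mul_top] at this
    simpa [Finsupp.single_apply] using this

/-- Idempotents lift along an ideal at which the ring is henselian. -/
theorem HenselianRing.exists_idempotent_lift {B : Type*} [CommRing B] (J : Ideal B)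
    [hens : HenselianRing B J] (a₀ : B) (h : a₀ ^ 2 - a₀ ∈ J) :
    ∃ a : B, a * (a - 1) = 0 ∧ a - a₀ ∈ J := by
  obtain ⟨a, ha, haJ⟩ := hens.is_henselian (Polynomial.X ^ 2 - Polynomial.X)
    (by
      nontriviality B
      exact Polynomial.monic_X_pow_sub (by rw [Polynomial.degree_X]; norm_num)) a₀ (by simpa using h)
    (by
      -- The derivative `2 a₀ - 1` is its own inverse modulo `J`, as its square is `1 + 4 (a₀² -
      -- a₀)`.
      refine IsUnit.of_mul_eq_one (Ideal.Quotient.mk J (2 * a₀ - 1)) ?_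
      rw [← map_mul, ← map_one (Ideal.Quotient.mk J), Ideal.Quotient.eq]
      have : (Polynomial.X ^ 2 - Polynomial.X : Polynomial B).derivative.eval a₀ = 2 * a₀ - 1 := by
        simp [one_add_one_eq_two]
      rw [this, show (2 * a₀ - 1) * (2 * a₀ - 1) - 1 = 4 * (a₀ ^ 2 - a₀) by ring]
      exact J.mul_mem_left _ h)
  refine ⟨a, ?_, haJ⟩
  have : a ^ 2 - a = 0 := by simpa using ha
  rw [← this]; ring

/-- A domain that is henselian along an ideal with artinian quotient is local, as idempotents
lift. -/
theorem HenselianRing.isLocalRing_of_isArtinianRing {B : Type*} [CommRing B] [IsDomain B]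
    (J : Ideal B) [hens : HenselianRing B J] [IsArtinianRing (B ⧸ J)] : IsLocalRing B := by
  have hunit : ∀ x : B, IsUnit (Ideal.Quotient.mk J x) → IsUnit x := fun x hx =>
    (isLocalHom_of_le_jacobson_bot J hens.jac).map_nonunit x hx
  refine IsLocalRing.of_isUnit_or_isUnit_one_sub_self fun b => ?_
  set β := Ideal.Quotient.mk J b with hβ
  -- The powers of `β` stabilize, so `(βγ)^(n+1)` is idempotent; the exponent `n + 1` keeps it
  -- divisible by `β` even for `n = 0`. Its lift to the domain `B` is `0` or `1`, making `β`
  -- nilpotent or a unit.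
  obtain ⟨n, γ, hγ⟩ := IsArtinian.exists_pow_succ_smul_dvd β (1 : B ⧸ J)
  rw [smul_eq_mul, smul_eq_mul, mul_one, Nat.succ_eq_add_one] at hγ
  have hγ' : ∀ j, β ^ n * (β * γ) ^ j = β ^ n := by
    intro j
    induction j with
    | zero => simp
    | succ j ih => rw [pow_succ, ← mul_assoc, ih, ← mul_assoc, ← pow_succ, hγ]
  obtain ⟨a₀, ha₀⟩ := Ideal.Quotient.mk_surjective ((β * γ) ^ (n + 1))
  have hidem : ((β * γ) ^ (n + 1)) ^ 2 = (β * γ) ^ (n + 1) := by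
    have h := hγ' (n + 1)
    calc ((β * γ) ^ (n + 1)) ^ 2 = (β ^ n * (β * γ) ^ (n + 1)) * (β * γ ^ (n + 1)) := by ring
      _ = (β * γ) ^ (n + 1) := by rw [h]; ring
  obtain ⟨a, ha1, haJ⟩ := HenselianRing.exists_idempotent_lift J a₀ (by
    rw [← Ideal.Quotient.eq_zero_iff_mem, map_sub, map_pow, ha₀, hidem, sub_self])
  rw [← Ideal.Quotient.eq_zero_iff_mem, map_sub, ha₀, sub_eq_zero] at haJ
  rcases mul_eq_zero.1 ha1 with h0 | h1
  · right
    apply hunit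
    rw [map_sub, map_one]
    refine IsNilpotent.isUnit_one_sub ⟨n, ?_⟩
    rw [← hβ, ← hγ' (n + 1), ← haJ, h0, map_zero, mul_zero]
  · left
    apply hunit
    rw [sub_eq_zero.1 h1, map_one] at haJ
    refine IsUnit.of_mul_eq_one (β ^ n * γ ^ (n + 1)) ?_
    rw [haJ, ← hβ]; ring

/-- A domain that is finite free over a complete noetherian local ring is local. -/
theorem IsLocalRing.of_free_of_isAdicComplete {R B : Type*} [CommRing R] [CommRing B] [IsDomain B]
    [Algebra R B] [IsNoetherianRing R] [IsLocalRing R] [IsAdicComplete (IsLocalRing.maximalIdeal R) R]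
    [Module.Finite R B] [Module.Free R B] : IsLocalRing B := by
  set J : Ideal B := (IsLocalRing.maximalIdeal R).map (algebraMap R B) with hJ
  have : IsAdicComplete J B := IsAdicComplete.map_of_free _
  let κ := R ⧸ IsLocalRing.maximalIdeal R
  let : Field κ := Ideal.Quotient.field _
  let : Algebra κ (B ⧸ J) := Ideal.Quotient.algebraQuotientOfLEComap Ideal.le_comap_map
  have : IsScalarTower R κ (B ⧸ J) := IsScalarTower.of_algebraMap_eq fun _ => rfl
  have : Module.Finite κ (B ⧸ J) := Module.Finite.of_restrictScalars_finite R κ (B ⧸ J)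
  have : IsArtinianRing (B ⧸ J) := IsArtinianRing.of_finite κ (B ⧸ J)
  exact HenselianRing.isLocalRing_of_isArtinianRing J

/-- The integral closure of a complete discrete valuation ring in an extension field is local. -/
theorem IsLocalRing.integralClosure_of_isAdicComplete {R F : Type*} [CommRing R] [IsDomain R]
    [IsPrincipalIdealRing R] [IsLocalRing R] [IsAdicComplete (IsLocalRing.maximalIdeal R) R]
    [Field F] [Algebra R F] [FaithfulSMul R F] : IsLocalRing (integralClosure R F) := by
  refine IsLocalRing.of_isUnit_or_isUnit_one_sub_self fun b => ?_
  have hb : IsIntegral R (b : F) := b.2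
  -- Locality concerns only `b` and `1 - b`, so it can be tested in a subalgebra that is finite over
  -- `R`, and free because it is torsion-free over a principal ideal domain.
  let B := Algebra.adjoin R {(b : F)}
  have : Module.Finite R B := Module.Finite.iff_fg.2 hb.fg_adjoin_singleton
  have : Module.IsTorsionFree R B := inferInstance
  have : Module.Free R B := Module.free_of_finite_type_torsion_free'
  have : IsLocalRing B := IsLocalRing.of_free_of_isAdicComplete (R := R)
  have hle : B ≤ integralClosure R F := Algebra.adjoin_le (by simp)
  let β : B := ⟨b, Algebra.self_mem_adjoin_singleton R _⟩
  rcases IsLocalRing.isUnit_or_isUnit_one_sub_self β with h | h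
  · exact Or.inl (h.map (Subalgebra.inclusion hle))
  · exact Or.inr (h.map (Subalgebra.inclusion hle))

section PowerSeries

variable {k E : Type*} [Field k] [Field E] {O : ValuationSubring E} (e : O ≃+* PowerSeries k)

include e in
theorem ValuationSubring.isPrincipalIdealRing_of_equiv_powerSeries : IsPrincipalIdealRing O :=
  IsPrincipalIdealRing.of_surjective e.symm e.symm.surjective

include e in
theorem ValuationSubring.isAdicComplete_of_equiv_powerSeries :
    IsAdicComplete (IsLocalRing.maximalIdeal O) O := by
  have h := (IsAdicComplete.congr_ringEquiv (IsLocalRing.maximalIdeal (PowerSeries k)) e.symm).2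
    (by rw [PowerSeries.maximalIdeal_eq_span_X]; infer_instance)
  have h2 : (IsLocalRing.maximalIdeal (PowerSeries k)).map e.symm = IsLocalRing.maximalIdeal O := by
    exact IsLocalRing.map_ringEquiv_maximalIdeal e.symm
  rwa [h2] at h

/-- Identifies the Jacobson radical in the definition of inertia with a maximal ideal, hence a prime
one. -/
theorem isLocalRing_integralClosure (e : O ≃+* PowerSeries k) (F : Type*) [Field F] [Algebra E F] :
    IsLocalRing (integralClosure O F) := by
  have := ValuationSubring.isPrincipalIdealRing_of_equiv_powerSeries e
  have := ValuationSubring.isAdicComplete_of_equiv_powerSeries e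
  have : FaithfulSMul O F := inferInstance
  exact IsLocalRing.integralClosure_of_isAdicComplete

end PowerSeries

end LocalIntegralClosure

/-! ### Sylow decomposition in profinite abelian groups. -/

section ProfiniteAbelian

theorem mem_of_pow_mem_of_coprime {G : Type*} [CommGroup G] {H : Subgroup G} {x : G} {m n : ℕ} (h : m.Coprime n)
    (hm : x ^ m ∈ H) (hn : x ^ n ∈ H) : x ∈ H := by
  have h1 : x = (x ^ m) ^ (m.gcdA n) * (x ^ n) ^ (m.gcdB n) := by
    rw [← zpow_natCast, ← zpow_natCast, ← zpow_mul, ← zpow_mul, ← zpow_add, ← Nat.gcd_eq_gcd_ab,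
      h.gcd_eq_one, Nat.cast_one, zpow_one]
  rw [h1]
  exact mul_mem (H.zpow_mem hm _) (H.zpow_mem hn _)

variable {G : Type*} [CommGroup G] [TopologicalSpace G]

/-- The elements `x` such that for every open subgroup `U` some power of `x` with exponent in `M`
lies in `U`. For `M` the powers of `p` this is the pro-`p` part of a profinite abelian group. -/
def profinitePart (M : Submonoid ℕ) : Subgroup G :=
  ⨅ U : OpenSubgroup G,
    { carrier := {x | ∃ m ∈ M, x ^ m ∈ U}
      one_mem' := ⟨1, M.one_mem, by simp⟩
      mul_mem' := by
        rintro x y ⟨m, hm, hx⟩ ⟨n, hn, hy⟩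
        refine ⟨m * n, M.mul_mem hm hn, ?_⟩
        rw [mul_pow, pow_mul, mul_comm m n, pow_mul]
        exact mul_mem (pow_mem hx n) (pow_mem hy m)
      inv_mem' := by
        rintro x ⟨m, hm, hx⟩
        exact ⟨m, hm, by simpa using hx⟩ }

theorem mem_profinitePart {M : Submonoid ℕ} {x : G} :
    x ∈ profinitePart M ↔ ∀ U : OpenSubgroup G, ∃ m ∈ M, x ^ m ∈ U := by
  simp only [profinitePart, Subgroup.mem_iInf]
  rfl

/-- The natural numbers prime to `p`. -/
def primeToSubmonoid (p : ℕ) : Submonoid ℕ where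
  carrier := {m | p.Coprime m}
  one_mem' := Nat.coprime_one_right p
  mul_mem' := fun hm hn => Nat.Coprime.mul_right hm hn

theorem coprime_of_mem_powers_of_mem_primeTo {p m n : ℕ} (hm : m ∈ Submonoid.powers p)
    (hn : n ∈ primeToSubmonoid p) : m.Coprime n := by
  obtain ⟨a, rfl⟩ := hm
  exact Nat.Coprime.pow_left a hn

variable [IsTopologicalGroup G]

/-- The set is a union of cosets of the open subgroup `U`, so its complement is open as well. -/
theorem isClosed_setOf_exists_pow_mem (M : Submonoid ℕ) (U : OpenSubgroup G) :
    IsClosed {x : G | ∃ m ∈ M, x ^ m ∈ U} := by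
  refine ⟨isOpen_iff_mem_nhds.2 fun x hx => ?_⟩
  have hU : (fun y => y⁻¹ * x) ⁻¹' (U : Set G) ∈ nhds x := by
    refine (U.isOpen.preimage (by fun_prop)).mem_nhds ?_
    simp
  filter_upwards [hU] with y hy hy'
  obtain ⟨m, hm, hym⟩ := hy'
  refine hx ⟨m, hm, ?_⟩
  have : x ^ m = y ^ m * (y⁻¹ * x) ^ m := by rw [← mul_pow, mul_inv_cancel_left]
  rw [this]
  exact mul_mem hym (pow_mem hy m)

theorem isClosed_profinitePart (M : Submonoid ℕ) : IsClosed ((profinitePart M : Subgroup G) : Set G) := by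
  have : ((profinitePart M : Subgroup G) : Set G) = ⋂ U : OpenSubgroup G, {x | ∃ m ∈ M, x ^ m ∈ U} := by
    ext x
    simp only [SetLike.mem_coe, mem_profinitePart, Set.mem_iInter, Set.mem_ofPred_eq]
  rw [this]
  exact isClosed_iInter fun U => isClosed_setOf_exists_pow_mem M U

variable [CompactSpace G]

theorem OpenSubgroup.index_ne_zero (U : OpenSubgroup G) : (U : Subgroup G).index ≠ 0 := by
  have : (U : Subgroup G).FiniteIndex := (U : Subgroup G).finiteIndex_of_finite_quotient
  exact Subgroup.FiniteIndex.index_ne_zero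

/-- Every element of a closed subgroup `I` is a product of an element of the pro-`p` part and one of
the prime-to-`p` part. -/
theorem exists_mul_mem_profinitePart (p : ℕ) [hp : Fact p.Prime] {I : Subgroup G}
    (hI : IsClosed (I : Set G)) {x : G} (hx : x ∈ I) :
    ∃ y ∈ I ⊓ profinitePart (Submonoid.powers p), ∃ z ∈ I ⊓ profinitePart (primeToSubmonoid p),
      x = y * z := by
  -- `t U` is the set of pro-`p` components of `x` that are correct modulo `U`. Bézout for the index
  -- of `U` makes each nonempty, and compactness gives a common element.
  let t : OpenSubgroup G → Set G := fun U =>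
    (I : Set G) ∩ {y | ∃ m ∈ Submonoid.powers p, y ^ m ∈ U} ∩
      (fun y => y⁻¹ * x) ⁻¹' {z | ∃ m ∈ primeToSubmonoid p, z ^ m ∈ U}
  have hmono : Monotone t := by
    rintro U V hUV y ⟨⟨hyI, m, hm, hy⟩, n, hn, hy'⟩
    exact ⟨⟨hyI, m, hm, hUV hy⟩, n, hn, hUV hy'⟩
  have hcl : ∀ U, IsClosed (t U) := fun U =>
    (hI.inter (isClosed_setOf_exists_pow_mem _ U)).inter
      ((isClosed_setOf_exists_pow_mem _ U).preimage (by fun_prop))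
  have hne : ∀ U, (t U).Nonempty := by
    intro U
    obtain ⟨a, m, hpm, hN⟩ := Nat.exists_eq_pow_mul_and_not_dvd U.index_ne_zero p hp.out.ne_one
    have hcop : p.Coprime m := (Nat.Prime.coprime_iff_not_dvd hp.out).2 hpm
    have hxN : x ^ (p ^ a * m) ∈ U := hN ▸ Subgroup.pow_index_mem (U : Subgroup G) x
    have hbez : x = (x ^ (p ^ a)) ^ ((p ^ a).gcdA m) * (x ^ m) ^ ((p ^ a).gcdB m) := by
      rw [← zpow_natCast, ← zpow_natCast, ← zpow_mul, ← zpow_mul, ← zpow_add, ← Nat.gcd_eq_gcd_ab,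
        (hcop.pow_left a).gcd_eq_one, Nat.cast_one, zpow_one]
    refine ⟨(x ^ m) ^ ((p ^ a).gcdB m), ⟨I.zpow_mem (pow_mem hx m) _, p ^ a, ⟨a, rfl⟩, ?_⟩,
      m, hcop, ?_⟩
    · rw [← zpow_natCast, zpow_comm, zpow_natCast, ← pow_mul, mul_comm m]
      exact Subgroup.zpow_mem _ hxN _
    · have : ((x ^ m) ^ ((p ^ a).gcdB m))⁻¹ * x = (x ^ (p ^ a)) ^ ((p ^ a).gcdA m) := by
        rw [inv_mul_eq_iff_eq_mul, mul_comm]; exact hbez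
      change (((x ^ m) ^ ((p ^ a).gcdB m))⁻¹ * x) ^ m ∈ U
      rw [this, ← zpow_natCast, zpow_comm, zpow_natCast, ← pow_mul]
      exact Subgroup.zpow_mem _ hxN _
  obtain ⟨y, hy⟩ := IsCompact.nonempty_iInter_of_directed_nonempty_isCompact_isClosed t
    (fun U V => ⟨U ⊓ V, hmono inf_le_left, hmono inf_le_right⟩) hne
    (fun U => (hcl U).isCompact) hcl
  rw [Set.mem_iInter] at hy
  have hyI : y ∈ I := (hy ⊤).1.1
  exact ⟨y, ⟨hyI, mem_profinitePart.2 fun U => (hy U).1.2⟩, y⁻¹ * x,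
    ⟨I.mul_mem (I.inv_mem hyI) hx, mem_profinitePart.2 fun U => (hy U).2⟩, by simp⟩

theorem isProPSylow_inf_profinitePart (p : ℕ) [hp : Fact p.Prime] {I : Subgroup G}
    (hI : IsClosed (I : Set G)) : IsProPSylow p (I ⊓ profinitePart (Submonoid.powers p)) I where
  le := inf_le_left
  isClosed := hI.inter (isClosed_profinitePart _)
  pro_p U := by
    set P := I ⊓ profinitePart (Submonoid.powers p)
    have hfin : (U : Subgroup G).relIndex P ≠ 0 := by
      have : (U : Subgroup G).FiniteIndex := ⟨U.index_ne_zero⟩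
      exact Subgroup.FiniteIndex.index_ne_zero
    have : Finite (P ⧸ (U : Subgroup G).subgroupOf P) := Nat.finite_of_card_ne_zero hfin
    refine IsPGroup.exists_card_eq (p := p) (G := P ⧸ (U : Subgroup G).subgroupOf P) fun q => ?_
    obtain ⟨x, rfl⟩ := QuotientGroup.mk_surjective q
    obtain ⟨m, ⟨n, rfl⟩, hx⟩ := mem_profinitePart.1 x.2.2 U
    exact ⟨n, (QuotientGroup.eq_one_iff _).2 hx⟩
  index_prime_to_p U hU hdvd := by
    have hfin : (U : Subgroup G).relIndex I ≠ 0 := by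
      have : (U : Subgroup G).FiniteIndex := ⟨U.index_ne_zero⟩
      exact Subgroup.FiniteIndex.index_ne_zero
    have : Finite (I ⧸ (U : Subgroup G).subgroupOf I) := Nat.finite_of_card_ne_zero hfin
    -- By Cauchy there would be `x ∉ U` with `x^p ∈ U`. Its pro-`p` factor lies in `U`, so a power
    -- of `x` with exponent prime to `p` does too, forcing `x ∈ U`.
    obtain ⟨q, hq⟩ := exists_prime_orderOf_dvd_card' (G := I ⧸ (U : Subgroup G).subgroupOf I) p hdvd
    obtain ⟨x, rfl⟩ := QuotientGroup.mk_surjective q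
    have hxp : (x : G) ^ p ∈ (U : Subgroup G) := by
      have := pow_orderOf_eq_one (x : I ⧸ (U : Subgroup G).subgroupOf I)
      rw [hq] at this
      exact (QuotientGroup.eq_one_iff (x ^ p)).1 this
    obtain ⟨y, hy, z, hz, hxyz⟩ := exists_mul_mem_profinitePart p hI x.2
    obtain ⟨m, hm, hzm⟩ := mem_profinitePart.1 hz.2 U
    have hxm : (x : G) ^ m ∈ (U : Subgroup G) := by
      rw [hxyz, mul_pow]
      exact mul_mem (pow_mem (hU hy) m) hzm
    have hxU : (x : G) ∈ (U : Subgroup G) := mem_of_pow_mem_of_coprime hm hxp hxm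
    have : (x : I ⧸ (U : Subgroup G).subgroupOf I) = 1 := (QuotientGroup.eq_one_iff x).2 hxU
    rw [this, orderOf_one] at hq
    exact hp.out.one_lt.ne hq

/-- A closed subgroup is the intersection of the open subgroups `N` containing it. Modulo such an
`N`, an element of the pro-`p` part of `I` has both `p`-power order and order prime to `p`. -/
theorem IsProPSylow.eq_inf_profinitePart [TotallyDisconnectedSpace G] {p : ℕ} [hp : Fact p.Prime]
    {I Q : Subgroup G} (hQ : IsProPSylow p Q I) :
    Q = I ⊓ profinitePart (Submonoid.powers p) := by
  apply le_antisymm <;> intro x hx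
  · refine ⟨hQ.le hx, mem_profinitePart.2 fun U => ?_⟩
    obtain ⟨n, hn⟩ := hQ.pro_p U
    exact ⟨p ^ n, ⟨n, rfl⟩, hn ▸ Subgroup.pow_relIndex_mem (U : Subgroup G) hx⟩
  · have h := ProfiniteGrp.closedSubgroup_eq_sInf_open (⟨Q, hQ.isClosed⟩ : ClosedSubgroup G)
    change Q = _ at h
    rw [h, Subgroup.mem_sInf]
    rintro N ⟨hN, hQN⟩
    obtain ⟨m, hm, hxm⟩ := mem_profinitePart.1 hx.2 ⟨N, hN⟩
    have hcop : p.Coprime (N.relIndex I) :=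
      (Nat.Prime.coprime_iff_not_dvd hp.out).2 (hQ.index_prime_to_p ⟨N, hN⟩ hQN)
    exact mem_of_pow_mem_of_coprime (coprime_of_mem_powers_of_mem_primeTo hm hcop) hxm
      (Subgroup.pow_relIndex_mem N hx.1)

theorem eq_one_of_mem_profinitePart [TotallyDisconnectedSpace G] [T2Space G] {p : ℕ} {x : G}
    (hx : x ∈ profinitePart (Submonoid.powers p)) (hx' : x ∈ profinitePart (primeToSubmonoid p)) :
    x = 1 := by
  have h := ProfiniteGrp.closedSubgroup_eq_sInf_open
    (⟨⊥, isClosed_singleton⟩ : ClosedSubgroup G)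
  change (⊥ : Subgroup G) = _ at h
  rw [← Subgroup.mem_bot, h, Subgroup.mem_sInf]
  rintro N ⟨hN, -⟩
  obtain ⟨m, hm, hxm⟩ := mem_profinitePart.1 hx ⟨N, hN⟩
  obtain ⟨n, hn, hxn⟩ := mem_profinitePart.1 hx' ⟨N, hN⟩
  exact mem_of_pow_mem_of_coprime (coprime_of_mem_powers_of_mem_primeTo hm hn) hxm hxn

/-- A continuous bijective homomorphism from a compact group to a Hausdorff group is an isomorphism
of topological groups. -/
noncomputable def ContinuousMulEquiv.ofBijectiveCompact {A B : Type*} [Group A] [TopologicalSpace A]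
    [CompactSpace A] [Group B] [TopologicalSpace B] [T2Space B] (f : A →* B) (hf : Continuous f)
    (hb : Function.Bijective f) : A ≃ₜ* B :=
  { MulEquiv.ofBijective f hb with
    continuous_toFun := hf
    continuous_invFun :=
      (Continuous.homeoOfEquivCompactToT2 (f := (MulEquiv.ofBijective f hb).toEquiv) hf).symm.continuous }

/-- A closed direct factor `I` of a profinite abelian group splits further into its unique
pro-`p`-Sylow subgroup and the quotient by it. -/
theorem exists_proPSylow_splitting [TotallyDisconnectedSpace G] [T2Space G] (p : ℕ)
    [hp : Fact p.Prime] {I : Subgroup G} (hI : IsClosed (I : Set G)) {A : Type*} [CommGroup A]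
    [TopologicalSpace A] [CompactSpace A] (φ : I × A ≃ₜ* G) (hφ : ∀ x : I, φ (x, 1) = x) :
    ∃ P : Subgroup G, IsProPSylow p P I ∧ (∀ Q : Subgroup G, IsProPSylow p Q I → Q = P) ∧
      ∃ Φ : P × (I ⧸ P.subgroupOf I) × A ≃ₜ* G,
        (∀ x : P, Φ (x, 1, 1) = x) ∧
        (∀ y : I, ∃ x : P, Φ (1, QuotientGroup.mk y, 1) = x * y) ∧
        (∀ z, (φ.symm (Φ z)).2 = z.2.2) := by
  set P := I ⊓ profinitePart (Submonoid.powers p) with hP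
  set T := I ⊓ profinitePart (primeToSubmonoid p) with hT
  have hPS := isProPSylow_inf_profinitePart p hI
  have hTcl : IsClosed (T : Set G) := hI.inter (isClosed_profinitePart _)
  have : CompactSpace P := isCompact_iff_compactSpace.1 hPS.isClosed.isCompact
  have : CompactSpace T := isCompact_iff_compactSpace.1 hTcl.isCompact
  have : IsClosed ((P.subgroupOf I : Subgroup I) : Set I) :=
    hPS.isClosed.preimage continuous_subtype_val
  -- The prime-to-`p` part is a complement of `P` in `I`; inverting `f` chooses representatives of
  -- the classes continuously.
  let f : T →* I ⧸ P.subgroupOf I :=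
    (QuotientGroup.mk' _).comp (Subgroup.inclusion (inf_le_left : T ≤ I))
  have hf : Continuous f := QuotientGroup.continuous_mk.comp (continuous_subtype_val.subtype_mk _)
  have hfb : Function.Bijective f := by
    constructor
    · rw [injective_iff_map_eq_one]
      intro x hx
      have hxP : (x : G) ∈ P := (QuotientGroup.eq_one_iff (⟨x, x.2.1⟩ : I)).1 hx
      exact Subtype.ext (eq_one_of_mem_profinitePart hxP.2 x.2.2)
    · intro q
      obtain ⟨x, rfl⟩ := QuotientGroup.mk_surjective q
      obtain ⟨y, hy, z, hz, hxyz⟩ := exists_mul_mem_profinitePart p hI x.2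
      refine ⟨⟨z, hz⟩, QuotientGroup.eq.2 ?_⟩
      change z⁻¹ * (x : G) ∈ P
      rwa [hxyz, mul_comm y, inv_mul_cancel_left]
  let f' := ContinuousMulEquiv.ofBijectiveCompact f hf hfb
  let g : P × T × A →* G :=
    { toFun := fun z => φ (⟨z.1, z.1.2.1⟩ * ⟨z.2.1, z.2.1.2.1⟩, z.2.2)
      map_one' := by
        refine Eq.trans (congrArg φ (?_ : _ = (1 : I × A))) (map_one φ)
        exact Prod.ext (Subtype.ext (mul_one 1)) rfl
      map_mul' := by
        intro a b
        rw [← map_mul]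
        congr 1
        refine Prod.ext (Subtype.ext ?_) rfl
        exact mul_mul_mul_comm _ _ _ _ }
  have hg : Continuous g := by
    refine φ.continuous.comp ?_
    fun_prop
  have hgb : Function.Bijective g := by
    constructor
    · rw [injective_iff_map_eq_one]
      rintro ⟨x, y, a⟩ h
      have h1 : ((⟨x, x.2.1⟩ * ⟨y, y.2.1⟩, a) : I × A) = 1 :=
        φ.injective (h.trans (map_one φ).symm)
      have ha : a = 1 := congrArg Prod.snd h1
      have hxy : (x : G) * y = 1 := congrArg Subtype.val (congrArg Prod.fst h1)
      have hx : (x : G) = (y : G)⁻¹ := eq_inv_of_mul_eq_one_left hxy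
      have hx1 : (x : G) = 1 :=
        eq_one_of_mem_profinitePart x.2.2 (hx ▸ inv_mem y.2.2)
      have hy1 : (y : G) = 1 := by rwa [hx1, one_mul] at hxy
      exact Prod.ext (Subtype.ext hx1) (Prod.ext (Subtype.ext hy1) ha)
    · intro w
      obtain ⟨⟨x, a⟩, rfl⟩ := φ.surjective w
      obtain ⟨y, hy, z, hz, hxyz⟩ := exists_mul_mem_profinitePart p hI x.2
      exact ⟨(⟨y, hy⟩, ⟨z, hz⟩, a), congrArg φ (Prod.ext (Subtype.ext hxyz.symm) rfl)⟩
  let g' := ContinuousMulEquiv.ofBijectiveCompact g hg hgb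
  let h : P × (I ⧸ P.subgroupOf I) × A ≃ₜ* P × T × A :=
    { toFun := fun z => (z.1, f'.symm z.2.1, z.2.2)
      invFun := fun z => (z.1, f' z.2.1, z.2.2)
      left_inv := fun z => by simp
      right_inv := fun z => by simp
      map_mul' := fun a b => by simp
      continuous_toFun := by fun_prop
      continuous_invFun := by fun_prop }
  have hval : ∀ z, h.trans g' z =
      φ (⟨z.1, z.1.2.1⟩ * ⟨f'.symm z.2.1, (f'.symm z.2.1).2.1⟩, z.2.2) := fun z => rfl
  refine ⟨P, hPS, fun Q hQ => hQ.eq_inf_profinitePart, h.trans g', fun x => ?_, fun y => ?_,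
    fun z => ?_⟩
  · rw [hval]
    have h1 : (⟨(f'.symm 1 : T), (f'.symm 1).2.1⟩ : I) = 1 :=
      by
      refine Subtype.ext ?_
      change ((f'.symm 1 : T) : G) = 1
      rw [map_one]; rfl
    simp only [h1, mul_one, hφ]
  · rw [hval]
    set t := f'.symm (QuotientGroup.mk y)
    have ht : f' t = QuotientGroup.mk y := f'.apply_symm_apply _
    have h1 : (y : G)⁻¹ * t ∈ P := QuotientGroup.eq (s := P.subgroupOf I).1 ht.symm
    refine ⟨⟨_, h1⟩, ?_⟩
    have h2 : (⟨((1 : P) : G), (1 : P).2.1⟩ : I) = 1 := rfl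
    simp only [h2, one_mul, hφ]
    rw [mul_comm, mul_inv_cancel_left]
  · rw [hval, ContinuousMulEquiv.symm_apply_apply]

end ProfiniteAbelian

/-! ### Functoriality and topology of abelianizations. -/

section Abelianization

variable {G H : Type*} [Group G] [TopologicalSpace G] [IsTopologicalGroup G]
  [Group H] [TopologicalSpace H] [IsTopologicalGroup H]

theorem ContinuousMonoidHom.map_mem_commutator_topologicalClosure (f : G →ₜ* H) {x : G}
    (hx : x ∈ (commutator G).topologicalClosure) : f x ∈ (commutator H).topologicalClosure := by
  have h : (commutator G).topologicalClosure ≤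
      ((commutator H).topologicalClosure).comap f.toMonoidHom := by
    refine Subgroup.topologicalClosure_minimal _ ?_
      ((Subgroup.isClosed_topologicalClosure _).preimage f.continuous_toFun)
    rw [← Subgroup.map_le_iff_le_comap]
    refine le_trans ?_ (Subgroup.le_topologicalClosure _)
    rw [commutator_def, Subgroup.map_commutator]
    exact Subgroup.commutator_mono le_top le_top
  exact h hx

/-- The homomorphism of abelianizations induced by a continuous homomorphism. -/
def TopologicalAbelianization.map (f : G →ₜ* H) :
    TopologicalAbelianization G →ₜ* TopologicalAbelianization H where
  toMonoidHom := QuotientGroup.map _ _ f.toMonoidHom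
    fun _ hx => f.map_mem_commutator_topologicalClosure hx
  continuous_toFun := by
    refine (QuotientGroup.isQuotientMap_mk _).continuous_iff.2 ?_
    exact QuotientGroup.continuous_mk.comp f.continuous_toFun

@[simp]
theorem TopologicalAbelianization.map_mk (f : G →ₜ* H) (x : G) :
    TopologicalAbelianization.map f (QuotientGroup.mk x) = QuotientGroup.mk (f x) := rfl

instance TopologicalAbelianization.isClosed_commutator :
    IsClosed ((commutator G).topologicalClosure : Set G) :=
  Subgroup.isClosed_topologicalClosure _

/-- A quotient of a profinite group by a closed normal subgroup is totally disconnected. -/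
theorem QuotientGroup.totallyDisconnectedSpace_of_isClosed [CompactSpace G]
    [TotallyDisconnectedSpace G] (N : Subgroup G) [N.Normal] [IsClosed (N : Set G)] :
    TotallyDisconnectedSpace (G ⧸ N) := by
  have : NonarchimedeanGroup (G ⧸ N) := by
    refine ⟨fun U hU => ?_⟩
    obtain ⟨V, hVU, hV, h1⟩ := mem_nhds_iff.1 hU
    obtain ⟨W, hW⟩ := ProfiniteGrp.exist_openNormalSubgroup_sub_open_nhds_of_one
      (hV.preimage QuotientGroup.continuous_mk) (U := QuotientGroup.mk ⁻¹' V)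
      (by rw [Set.mem_preimage, QuotientGroup.mk_one]; exact h1)
    refine ⟨⟨W.toSubgroup.map (QuotientGroup.mk' N), ?_⟩, ?_⟩
    · exact QuotientGroup.isOpenMap_coe _ W.isOpen
    · rintro _ ⟨x, hx, rfl⟩
      exact hVU (hW hx)
  infer_instance

end Abelianization

/-! ### Infinite Galois groups and maximal abelian extensions. -/

section GaloisGroups

variable {K L : Type*} [Field K] [Field L] [Algebra K L]

/-- A homomorphism to a Galois group is continuous if the elements that fix any given `x` form an
open set. -/
theorem continuous_of_isOpen_setOf_apply_eq {G : Type*} [Group G] [TopologicalSpace G]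
    [IsTopologicalGroup G] (f : G →* Gal(L/K)) (h : ∀ x, IsOpen {g | f g x = x}) :
    Continuous f := by
  refine continuous_of_continuousAt_one f fun A hA => ?_
  rw [map_one, krullTopology_mem_nhds_one_iff] at hA
  obtain ⟨F, hF, hFA⟩ := hA
  let b := Module.finBasis K F
  have hopen : IsOpen (⋂ i, {g : G | f g (b i : L) = b i}) := isOpen_iInter_of_finite fun i => h _
  refine Filter.mem_map.2 (Filter.mem_of_superset (hopen.mem_nhds ?_) fun g hg => hFA ?_)
  · simp
  · have hlin : ((f g).toLinearMap ∘ₗ F.val.toLinearMap) = F.val.toLinearMap := by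
      refine b.ext fun i => ?_
      exact Set.mem_iInter.1 hg i
    exact (IntermediateField.mem_fixingSubgroup_iff F (f g)).2
      fun x hx => LinearMap.congr_fun hlin ⟨x, hx⟩

theorem mem_commutator_topologicalClosure_iff [IsGalois K L] {σ : Gal(L/K)} :
    σ ∈ (commutator Gal(L/K)).topologicalClosure ↔ ∀ x ∈ maxAbelianExt K L, σ x = x := by
  have h := InfiniteGalois.fixingSubgroup_fixedField
    (⟨(commutator Gal(L/K)).topologicalClosure, Subgroup.isClosed_topologicalClosure _⟩ :
      ClosedSubgroup Gal(L/K))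
  change (maxAbelianExt K L).fixingSubgroup = (commutator Gal(L/K)).topologicalClosure at h
  rw [← h, IntermediateField.mem_fixingSubgroup_iff]

theorem mem_maxAbelianExt_iff {x : L} :
    x ∈ maxAbelianExt K L ↔ ∀ σ ∈ (commutator Gal(L/K)).topologicalClosure, σ x = x :=
  IntermediateField.mem_fixedField_iff _ _

theorem galoisAbEquiv_mk_apply [IsGalois K L] (σ : Gal(L/K)) (x : maxAbelianExt K L) :
    (galoisAbEquiv K L (QuotientGroup.mk σ) x : L) = σ x := by
  have : Normal K (maxAbelianExt K L) := by
    unfold maxAbelianExt; infer_instance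
  exact AlgEquiv.restrictNormalHom_apply (maxAbelianExt K L) σ x

/-- Two embeddings of a normal extension that agree on the base field differ by an automorphism. -/
theorem exists_algEquiv_apply_eq [Normal K L] {M : Type*} [Field M] (j₁ j₂ : L →+* M)
    (h : ∀ a : K, j₁ (algebraMap K L a) = j₂ (algebraMap K L a)) :
    ∃ τ : Gal(L/K), ∀ x, j₁ x = j₂ (τ x) := by
  let : Algebra L M := j₂.toAlgebra
  let : Algebra K M := (j₂.comp (algebraMap K L)).toAlgebra
  have : IsScalarTower K L M := IsScalarTower.of_algebraMap_eq fun _ => rfl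
  let φ : L →ₐ[K] M := { j₁ with commutes' := h }
  refine ⟨Normal.algHomEquivAut K M L φ, fun x => ?_⟩
  have h1 := DFunLike.congr_fun ((Normal.algHomEquivAut K M L).symm_apply_apply φ) x
  exact h1.symm

end GaloisGroups

/-! ### Restriction of automorphisms along an embedding of fields. -/

section RestrictionToConstants

variable {k l E F : Type*} [Field k] [Field l] [Algebra k l] [Normal k l]
  [Field E] [Field F] [Algebra E F] {c : k →+* E} (j : l →+* F)
  (hj : ∀ a, j (algebraMap k l a) = algebraMap E F (c a))

include hj in
theorem exists_restriction (σ : Gal(F/E)) : ∃ τ : Gal(l/k), ∀ x, σ (j x) = j (τ x) :=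
  exists_algEquiv_apply_eq ((σ : F →+* F).comp j) j fun a => by simp [hj]

/-- Restriction of automorphisms along an embedding `j : l → F` of a normal extension `l / k` over
an embedding `k → E`, as a homomorphism of abstract groups. -/
noncomputable def restrictionMonoidHom : Gal(F/E) →* Gal(l/k) :=
  MonoidHom.mk' (fun σ => (exists_restriction j hj σ).choose) fun σ τ => by
    ext x
    apply j.injective
    rw [← (exists_restriction j hj (σ * τ)).choose_spec, AlgEquiv.mul_apply, AlgEquiv.mul_apply,
      ← (exists_restriction j hj σ).choose_spec, ← (exists_restriction j hj τ).choose_spec]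

theorem restrictionMonoidHom_spec (σ : Gal(F/E)) (x : l) :
    σ (j x) = j (restrictionMonoidHom j hj σ x) :=
  (exists_restriction j hj σ).choose_spec x

/-- Restriction of automorphisms along an embedding `j : l → F` of a normal extension `l / k` over
an embedding `k → E`. -/
noncomputable def restrictionHom [Algebra.IsIntegral E F] : Gal(F/E) →ₜ* Gal(l/k) where
  toMonoidHom := restrictionMonoidHom j hj
  continuous_toFun := by
    refine continuous_of_isOpen_setOf_apply_eq (restrictionMonoidHom j hj) fun x => ?_
    convert stabilizer_isOpen_of_isIntegral (K := E) (j x) using 1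
    ext σ
    change restrictionMonoidHom j hj σ x = x ↔ σ (j x) = j x
    rw [restrictionMonoidHom_spec j hj, j.injective.eq_iff]

theorem restrictionHom_spec [Algebra.IsIntegral E F] (σ : Gal(F/E)) (x : l) :
    σ (j x) = j (restrictionHom j hj σ x) :=
  restrictionMonoidHom_spec j hj σ x

end RestrictionToConstants

/-! ### Coefficientwise maps of Hahn series. -/

section HahnCoefficients

/-- The ring homomorphism of Hahn series rings given by a map of the coefficients. -/
def HahnSeries.mapRingHom {Γ R S : Type*} [AddCommMonoid Γ] [PartialOrder Γ]
    [IsOrderedCancelAddMonoid Γ] [Semiring R] [Semiring S] (f : R →+* S) :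
    HahnSeries Γ R →+* HahnSeries Γ S where
  toFun x := x.map f
  map_one' := HahnSeries.map_one f.toMonoidWithZeroHom
  map_mul' x y := HahnSeries.map_mul f.toNonUnitalRingHom
  map_zero' := by ext; simp
  map_add' x y := HahnSeries.map_add f.toAddMonoidHom

@[simp]
theorem HahnSeries.coeff_mapRingHom {Γ R S : Type*} [AddCommMonoid Γ] [PartialOrder Γ]
    [IsOrderedCancelAddMonoid Γ] [Semiring R] [Semiring S] (f : R →+* S) (x : HahnSeries Γ R)
    (γ : Γ) : (HahnSeries.mapRingHom f x).coeff γ = f (x.coeff γ) := rfl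

theorem HahnSeries.mapRingHom_C {Γ R S : Type*} [AddCommMonoid Γ] [PartialOrder Γ]
    [IsOrderedCancelAddMonoid Γ] [Semiring R] [Semiring S] (f : R →+* S) (a : R) :
    HahnSeries.mapRingHom (Γ := Γ) f (HahnSeries.C a) = HahnSeries.C (f a) :=
  HahnSeries.map_C a f

theorem HahnSeries.coeff_ofPowerSeries_mem {R Γ : Type*} [Semiring R] [Semiring Γ] [PartialOrder Γ]
    [IsStrictOrderedRing Γ] (x : PowerSeries R) (S : Set R) (h0 : 0 ∈ S)
    (hx : ∀ n, PowerSeries.coeff n x ∈ S) (γ : Γ) : (ofPowerSeries Γ R x).coeff γ ∈ S := by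
  by_cases h : ∃ n : ℕ, (n : Γ) = γ
  · obtain ⟨n, rfl⟩ := h
    rw [ofPowerSeries_apply_coeff]
    exact hx n
  · rw [ofPowerSeries_apply, embDomain_of_notMem_range]
    · exact h0
    · rintro ⟨n, hn⟩
      exact h ⟨n, hn⟩

end HahnCoefficients

/-! ### Extending automorphisms from `ks` to its algebraic closure. -/

section AutExtension

variable {k l : Type*} [Field k] [Field l] [Algebra k l]

/-- The extension of an automorphism of `l` to its algebraic closure. -/
noncomputable def algClosureExt (τ : Gal(l/k)) : AlgebraicClosure l ≃+* AlgebraicClosure l :=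
  IsAlgClosure.equivOfEquiv _ _ τ.toRingEquiv

theorem algClosureExt_algebraMap (τ : Gal(l/k)) (x : l) :
    algClosureExt τ (algebraMap l _ x) = algebraMap l _ (τ x) :=
  IsAlgClosure.equivOfEquiv_algebraMap _ _ τ.toRingEquiv x

/-- The extensions are arbitrary choices; they compose correctly because a map out of a purely
inseparable extension is determined on the base. -/
theorem algClosureExt_mul [IsSepClosed l] (σ τ : Gal(l/k)) :
    (algClosureExt (σ * τ) : AlgebraicClosure l →+* AlgebraicClosure l) =
      (algClosureExt σ : AlgebraicClosure l →+* AlgebraicClosure l).comp (algClosureExt τ) := by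
  refine IsPurelyInseparable.injective_comp_algebraMap l (AlgebraicClosure l) _ ?_
  ext x
  simp [algClosureExt_algebraMap]

variable (p : ℕ) [CharP l p]

theorem algClosureExt_apply_eq_iff [Fact p.Prime] {a : AlgebraicClosure l} {n : ℕ} {b : l}
    (h : algebraMap l _ b = a ^ p ^ n) (τ : Gal(l/k)) : algClosureExt τ a = a ↔ τ b = b := by
  have : CharP (AlgebraicClosure l) p := charP_of_injective_algebraMap (algebraMap l _).injective p
  constructor
  · intro ha
    apply (algebraMap l (AlgebraicClosure l)).injective
    rw [← algClosureExt_algebraMap, h, map_pow, ha]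
  · intro hb
    apply (iterateFrobenius (AlgebraicClosure l) p n).injective
    rw [iterateFrobenius_def, iterateFrobenius_def, ← map_pow, ← h, algClosureExt_algebraMap, hb]

theorem isClosed_setOf_algClosureExt_apply_eq [IsSepClosed l] [Fact p.Prime] [Algebra.IsIntegral k l]
    (a : AlgebraicClosure l) : IsClosed {τ : Gal(l/k) | algClosureExt τ a = a} := by
  obtain ⟨n, b, hb⟩ := IsPurelyInseparable.pow_mem l p a
  have : {τ : Gal(l/k) | algClosureExt τ a = a} = MulAction.stabilizer Gal(l/k) b := by
    ext τ
    exact algClosureExt_apply_eq_iff p hb τ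
  rw [this]
  exact Subgroup.isClosed_of_isOpen _ (stabilizer_isOpen_of_isIntegral b)

end AutExtension

/-! ### The embedding of `Es` into Hahn series and the section it yields. -/

section HahnEmbedding

variable {k ks E Es : Type*} [Field k] [Field ks] [Algebra k ks] [Field E] [Field Es]
  [Algebra E Es] {O : ValuationSubring E} (e : O ≃+* PowerSeries k)

/-- The embedding of the field of constants. -/
noncomputable def constantsEmbedding : k →+* E :=
  O.subtype.comp ((e.symm : PowerSeries k →+* O).comp PowerSeries.C)

variable (ks) in
/-- The embedding of the ring of power series into the field of Hahn series. -/
noncomputable def integersToHahn : O →+* HahnSeries ℚ (AlgebraicClosure ks) :=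
  (HahnSeries.ofPowerSeries ℚ (AlgebraicClosure ks)).comp
    ((PowerSeries.map ((algebraMap ks (AlgebraicClosure ks)).comp (algebraMap k ks))).comp
      (e : O →+* PowerSeries k))

theorem integersToHahn_injective : Function.Injective (integersToHahn ks e) :=
  HahnSeries.ofPowerSeries_injective.comp
    ((PowerSeries.map_injective ((algebraMap ks (AlgebraicClosure ks)).comp (algebraMap k ks))
      (RingHom.injective _)).comp e.injective)

variable (ks) in
/-- The embedding of the field of Laurent series into the field of Hahn series. -/
noncomputable def fieldToHahn : E →+* HahnSeries ℚ (AlgebraicClosure ks) :=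
  IsFractionRing.lift (A := O) (integersToHahn_injective (ks := ks) e)

theorem fieldToHahn_coe (x : O) : fieldToHahn ks e x = integersToHahn ks e x :=
  IsFractionRing.lift_algebraMap (integersToHahn_injective e) x

theorem fieldToHahn_constants (a : k) : fieldToHahn ks e (constantsEmbedding e a) =
    HahnSeries.C (algebraMap ks (AlgebraicClosure ks) (algebraMap k ks a)) := by
  refine (fieldToHahn_coe e _).trans ?_
  simp [integersToHahn, HahnSeries.ofPowerSeries_C]

/-- Series from `O` have coefficients in the image of `k`, which `τ` fixes; `E` is the fraction
field of `O`. -/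
theorem mapRingHom_fieldToHahn (τ : Gal(ks/k)) (x : E) :
    HahnSeries.mapRingHom (algClosureExt τ : AlgebraicClosure ks →+* AlgebraicClosure ks)
      (fieldToHahn ks e x) = fieldToHahn ks e x := by
  have h : (HahnSeries.mapRingHom (algClosureExt τ : AlgebraicClosure ks →+* AlgebraicClosure ks)).comp
      (fieldToHahn ks e) = fieldToHahn ks e := by
    refine IsLocalization.ringHom_ext (nonZeroDivisors O) ?_
    ext x γ
    simp only [RingHom.comp_apply, HahnSeries.coeff_mapRingHom]
    rw [show algebraMap O E x = (x : E) from rfl, fieldToHahn_coe]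
    refine HahnSeries.coeff_ofPowerSeries_mem _ {a | algClosureExt τ a = a} (map_zero _) (fun n => ?_) γ
    simp [PowerSeries.coeff_map, algClosureExt_algebraMap]
  exact RingHom.congr_fun h x

theorem orderTop_integersToHahn_nonneg (x : O) : 0 ≤ (integersToHahn ks e x).orderTop := by
  rw [HahnSeries.le_orderTop_iff_forall]
  intro γ hγ
  rw [integersToHahn, RingHom.comp_apply, HahnSeries.ofPowerSeries_apply,
    HahnSeries.embDomain_of_notMem_range]
  rintro ⟨n, rfl⟩
  have : ((n : ℚ) : WithTop ℚ) < 0 := hγ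
  exact absurd this (not_lt.2 (by exact_mod_cast Nat.cast_nonneg n))

variable (ks Es) in
theorem exists_sepClosure_to_hahn [Algebra.IsAlgebraic E Es] :
    ∃ ι : Es →+* HahnSeries ℚ (AlgebraicClosure ks),
      ∀ x, ι (algebraMap E Es x) = fieldToHahn ks e x := by
  let : Algebra E (HahnSeries ℚ (AlgebraicClosure ks)) := (fieldToHahn ks e).toAlgebra
  let ι : Es →ₐ[E] HahnSeries ℚ (AlgebraicClosure ks) := IsAlgClosed.lift
  exact ⟨ι, ι.commutes⟩

variable {e} {ι : Es →+* HahnSeries ℚ (AlgebraicClosure ks)}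
  (hι : ∀ x, ι (algebraMap E Es x) = fieldToHahn ks e x)

include hι in
-- For any embedding of `ks` over `k`, the composite with `ι` differs from the constant series by an
-- automorphism of `ks`, which is absorbed into `j`.
theorem exists_constants_embedding [IsSepClosed Es] [IsGalois k ks] :
    ∃ j : ks →+* Es, (∀ a, j (algebraMap k ks a) = algebraMap E Es (constantsEmbedding e a)) ∧
      ∀ x, ι (j x) = HahnSeries.C (algebraMap ks (AlgebraicClosure ks) x) := by
  let : Algebra k Es := ((algebraMap E Es).comp (constantsEmbedding e)).toAlgebra
  let j : ks →ₐ[k] Es := IsSepClosed.lift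
  have hj : ∀ a, j (algebraMap k ks a) = algebraMap E Es (constantsEmbedding e a) := j.commutes
  obtain ⟨α, hα⟩ := exists_algEquiv_apply_eq (K := k)
    (HahnSeries.C.comp (algebraMap ks (AlgebraicClosure ks))) (ι.comp j.toRingHom) fun a => by
      simp [hj, hι, fieldToHahn_constants]
  refine ⟨j.toRingHom.comp (α : ks →+* ks), fun a => ?_, fun x => (hα x).symm⟩
  simp [hj]

section Section

variable [IsGalois E Es]

include hι in
theorem exists_lift_automorphism (τ : Gal(ks/k)) : ∃ σ : Gal(Es/E), ∀ y,
    HahnSeries.mapRingHom (algClosureExt τ : AlgebraicClosure ks →+* AlgebraicClosure ks) (ι y) =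
      ι (σ y) :=
  exists_algEquiv_apply_eq (K := E) ((HahnSeries.mapRingHom (algClosureExt τ :
    AlgebraicClosure ks →+* AlgebraicClosure ks)).comp ι) ι fun a => by
      simp [hι, mapRingHom_fieldToHahn]

variable [IsSepClosed ks]

/-- The lift of automorphisms of the constants that acts on the coefficients of Hahn series, as a
homomorphism of abstract groups. -/
noncomputable def constantsLiftMonoidHom : Gal(ks/k) →* Gal(Es/E) :=
  MonoidHom.mk' (fun τ => (exists_lift_automorphism hι τ).choose) fun σ τ => by
    ext y
    apply ι.injective
    rw [← (exists_lift_automorphism hι (σ * τ)).choose_spec, AlgEquiv.mul_apply,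
      ← (exists_lift_automorphism hι σ).choose_spec, ← (exists_lift_automorphism hι τ).choose_spec,
      algClosureExt_mul]
    rfl

theorem constantsLiftMonoidHom_spec (τ : Gal(ks/k)) (y : Es) :
    HahnSeries.mapRingHom (algClosureExt τ : AlgebraicClosure ks →+* AlgebraicClosure ks) (ι y) =
      ι (constantsLiftMonoidHom hι τ y) :=
  (exists_lift_automorphism hι τ).choose_spec y

/-- The lift of automorphisms of the constants that acts on the coefficients of Hahn series. -/
noncomputable def constantsLift (p : ℕ) [Fact p.Prime] [CharP ks p] [Algebra.IsIntegral k ks] :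
    Gal(ks/k) →ₜ* Gal(Es/E) where
  toMonoidHom := constantsLiftMonoidHom hι
  continuous_toFun := by
    refine continuous_of_isOpen_setOf_apply_eq (constantsLiftMonoidHom hι) fun y => ?_
    let S : Subgroup Gal(Es/E) := MulAction.stabilizer Gal(Es/E) y
    have hSo : IsOpen (S : Set Gal(Es/E)) := stabilizer_isOpen_of_isIntegral y
    have : Finite (Gal(Es/E) ⧸ S) := S.quotient_finite_of_isOpen hSo
    have : S.FiniteIndex := S.finiteIndex_of_finite_quotient
    -- Fixing `y` means fixing its possibly infinitely many coefficients, which shows only that the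
    -- preimage is closed. Finite index, inherited from the stabilizer of `y`, makes it open.
    have : (S.comap (constantsLiftMonoidHom hι)).FiniteIndex := by
      refine ⟨?_⟩
      rw [Subgroup.index_comap]
      exact Subgroup.FiniteIndex.index_ne_zero
    have hcl : IsClosed ((S.comap (constantsLiftMonoidHom hι) : Subgroup Gal(ks/k)) : Set Gal(ks/k)) := by
      have : ((S.comap (constantsLiftMonoidHom hι) : Subgroup Gal(ks/k)) : Set Gal(ks/k)) =
          ⋂ γ : ℚ, {τ | algClosureExt τ ((ι y).coeff γ) = (ι y).coeff γ} := by
        ext τ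
        change constantsLiftMonoidHom hι τ y = y ↔ _
        rw [← ι.injective.eq_iff, ← constantsLiftMonoidHom_spec, Set.mem_iInter, HahnSeries.ext_iff,
          funext_iff]
        rfl
      rw [this]
      exact isClosed_iInter fun γ => isClosed_setOf_algClosureExt_apply_eq p _
    exact Subgroup.isOpen_of_isClosed_of_finiteIndex _ hcl

theorem constantsLift_apply (p : ℕ) [Fact p.Prime] [CharP ks p] [Algebra.IsIntegral k ks]
    {j : ks →+* Es} (hj : ∀ x, ι (j x) = HahnSeries.C (algebraMap ks (AlgebraicClosure ks) x))
    (τ : Gal(ks/k)) (x : ks) : constantsLift hι p τ (j x) = j (τ x) := by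
  apply ι.injective
  have h := constantsLiftMonoidHom_spec hι τ (j x)
  rw [hj, HahnSeries.mapRingHom_C] at h
  rw [hj]
  exact h.symm.trans (congrArg HahnSeries.C (algClosureExt_algebraMap τ x))

end Section

include hι in
-- The ring of Hahn series of nonnegative order is a valuation ring, hence integrally closed.
theorem orderTop_nonneg_of_isIntegral {y : Es} (hy : IsIntegral O y) : 0 ≤ (ι y).orderTop := by
  let A := Valuation.valuationSubring (HahnSeries.addVal ℚ (AlgebraicClosure ks) :
    Valuation (HahnSeries ℚ (AlgebraicClosure ks)) _)
  obtain ⟨P, hP, hP0⟩ := hy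
  let φ : O →+* A := (integersToHahn ks e).codRestrict A.toSubring
    fun x => orderTop_integersToHahn_nonneg e x
  have hint : IsIntegral A (ι y) := by
    refine ⟨P.map φ, hP.map φ, ?_⟩
    rw [Polynomial.eval₂_map]
    have : (algebraMap A _).comp φ = ι.comp (algebraMap O Es) := by
      ext1 x
      exact ((hι x).trans (fieldToHahn_coe e x)).symm
    rw [this, ← Polynomial.hom_eval₂, hP0, map_zero]
  obtain ⟨a, ha⟩ := IsIntegrallyClosed.isIntegral_iff.1 hint
  rw [← ha]
  exact a.2

theorem isIntegral_of_constants [Algebra.IsIntegral k ks] {j : ks →+* Es}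
    (hj : ∀ a, j (algebraMap k ks a) = algebraMap E Es (constantsEmbedding e a)) (x : ks) :
    IsIntegral O (j x) := by
  obtain ⟨P, hP, hP0⟩ := Algebra.IsIntegral.isIntegral (R := k) x
  let φ : k →+* O := (e.symm : PowerSeries k →+* O).comp PowerSeries.C
  refine ⟨P.map φ, hP.map φ, ?_⟩
  have : (algebraMap O Es).comp φ = j.comp (algebraMap k ks) := by
    ext1 a
    exact (hj a).symm
  rw [Polynomial.eval₂_map, this, ← Polynomial.hom_eval₂, hP0, map_zero]

include hι in
theorem not_isUnit_of_orderTop_pos {y : integralClosure O Es} (hy : 0 < (ι y).orderTop) :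
    ¬ IsUnit y := by
  intro hu
  obtain ⟨u, hu⟩ := hu.exists_right_inv
  have h1 : ι y * ι u = 1 := by
    rw [← map_mul, ← map_one ι]
    exact congrArg ι (congrArg Subtype.val hu)
  have h2 : (ι y).orderTop + (ι u).orderTop = 0 := by
    rw [← HahnSeries.addVal_apply, ← HahnSeries.addVal_apply, ← AddValuation.map_mul, h1,
      AddValuation.map_one]
  exact absurd h2 (add_pos_of_pos_of_nonneg hy (orderTop_nonneg_of_isIntegral hι u.2)).ne'

include hι in
/-- An automorphism that fixes the constants acts trivially modulo the maximal ideal. -/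
theorem smul_sub_mem_jacobson (p : ℕ) [Fact p.Prime] [CharP k p] [IsSepClosed ks]
    [Algebra.IsIntegral k ks] {j : ks →+* Es}
    (hjk : ∀ a, j (algebraMap k ks a) = algebraMap E Es (constantsEmbedding e a))
    (hj : ∀ x, ι (j x) = HahnSeries.C (algebraMap ks (AlgebraicClosure ks) x))
    {σ : Gal(Es/E)} (hσ : ∀ x, σ (j x) = j x) (y : integralClosure O Es) :
    σ • y - y ∈ Ideal.jacobson (⊥ : Ideal (integralClosure O Es)) := by
  have hloc := isLocalRing_integralClosure e Es
  have : CharP ks p := charP_of_injective_algebraMap (algebraMap k _).injective p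
  have : CharP Es p := charP_of_injective_ringHom j.injective p
  have : CharP (HahnSeries ℚ (AlgebraicClosure ks)) p := charP_of_injective_ringHom ι.injective p
  have : CharP (integralClosure O Es) p :=
    (algebraMap (integralClosure O Es) Es).charP (FaithfulSMul.algebraMap_injective _ _) p
  rw [IsLocalRing.jacobson_eq_maximalIdeal _ bot_ne_top]
  -- The residue of `y` need not lie in `ks`, but some `p^n`-th power of it does, so `y^(p^n)` is
  -- congruent to a constant fixed by `σ`.
  obtain ⟨n, b, hb⟩ := IsPurelyInseparable.pow_mem ks p ((ι y).coeff 0)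
  let β : integralClosure O Es := ⟨j b, isIntegral_of_constants hjk b⟩
  have hβ : σ • β = β := Subtype.ext (hσ b)
  have hz : y ^ p ^ n - β ∈ IsLocalRing.maximalIdeal (integralClosure O Es) := by
    refine (IsLocalRing.mem_maximalIdeal _).2 (not_isUnit_of_orderTop_pos hι ?_)
    have h1 : ι (y ^ p ^ n - β : integralClosure O Es) =
        (ι y - HahnSeries.single 0 ((ι y).coeff 0)) ^ p ^ n := by
      rw [sub_pow_char_pow]
      have : ι (j b) = HahnSeries.single (0 : ℚ) ((ι y).coeff 0) ^ p ^ n := by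
        rw [hj, hb, ← HahnSeries.C_apply, map_pow]
      rw [← this]
      simp [β]
    rw [h1]
    refine lt_of_lt_of_le (nsmul_pos (HahnSeries.lt_orderTop_sub_single (ι y) 0
      (orderTop_nonneg_of_isIntegral hι y.2)) (pow_ne_zero n (Fact.out : p.Prime).ne_zero))
      HahnSeries.orderTop_nsmul_le_orderTop_pow
  have hσz : σ • (y ^ p ^ n - β) ∈ IsLocalRing.maximalIdeal (integralClosure O Es) := by
    rw [IsLocalRing.mem_maximalIdeal, mem_nonunits_iff] at hz ⊢
    intro hu
    refine hz ?_
    have := hu.map (MulSemiringAction.toRingHom Gal(Es/E) (integralClosure O Es) σ⁻¹)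
    simpa using this
  -- In characteristic `p`, `(σy - y)^(p^n) = σ(y^(p^n)) - y^(p^n)`, and primality removes the
  -- exponent.
  refine (IsLocalRing.maximalIdeal.isMaximal _).isPrime.mem_of_pow_mem (p ^ n) ?_
  have := sub_mem hσz hz
  rw [smul_sub, hβ, sub_sub_sub_cancel_right, smul_pow'] at this
  rwa [sub_pow_char_pow]

end HahnEmbedding

/-! ### Inertia and the kernel of restriction to constants. -/

section Inertia

variable {k ks E Es : Type*} [Field k] [Field ks] [Algebra k ks] [Field E] [Field Es]
  [Algebra E Es] {O : ValuationSubring E}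

/-- The inverse of `z y + 1` found in the larger integral closure lies in `F` and is integral, so
the unit criterion for the Jacobson radical descends. -/
theorem mem_jacobson_integralClosure_of_coe (F : IntermediateField E Es) {z : integralClosure O F}
    {w : integralClosure O Es} (hzw : (w : Es) = (z : F))
    (hw : w ∈ Ideal.jacobson (⊥ : Ideal (integralClosure O Es))) :
    z ∈ Ideal.jacobson (⊥ : Ideal (integralClosure O F)) := by
  rw [Ideal.mem_jacobson_bot] at hw ⊢
  intro y
  have hint : ∀ x : F, IsIntegral O (x : Es) ↔ IsIntegral O x := fun x =>
    isIntegral_algHom_iff (IsScalarTower.toAlgHom O F Es) (algebraMap F Es).injective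
  obtain ⟨u, hu⟩ := (hw ⟨(y : F), (hint _).2 y.2⟩).exists_right_inv
  have hu1 : ((w : Es) * (y : F) + 1) * u = 1 := congrArg Subtype.val hu
  rw [hzw] at hu1
  have huF : ((((z : F) * y + 1)⁻¹ : F) : Es) = u := by
    refine inv_eq_of_mul_eq_one_right ?_
    exact hu1
  have hne : (z : F) * y + 1 ≠ 0 := by
    intro h0
    have : (((z : F) * y + 1 : F) : Es) * u = 1 := hu1
    rw [h0] at this
    simp at this
  have hv : IsIntegral O ((z : F) * y + 1)⁻¹ := (hint _).1 (huF ▸ u.2)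
  exact IsUnit.of_mul_eq_one ⟨_, hv⟩ (Subtype.ext (mul_inv_cancel₀ hne))

variable [IsGalois E Es]

theorem mk_mem_inertiaAb_iff {σ : Gal(Es/E)} :
    (QuotientGroup.mk σ : GaloisAb E Es) ∈ inertiaAb O Es ↔
      ∀ y : integralClosure O (maxAbelianExt E Es),
        galoisAbEquiv E Es (QuotientGroup.mk σ) • y - y ∈
          Ideal.jacobson (⊥ : Ideal (integralClosure O (maxAbelianExt E Es))) := Iff.rfl

theorem mk_mem_inertiaAb_of_forall {σ : Gal(Es/E)} (h : ∀ y : integralClosure O Es,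
    σ • y - y ∈ Ideal.jacobson (⊥ : Ideal (integralClosure O Es))) :
    (QuotientGroup.mk σ : GaloisAb E Es) ∈ inertiaAb O Es := by
  rw [mk_mem_inertiaAb_iff]
  intro y
  have hy : IsIntegral O ((y : maxAbelianExt E Es) : Es) :=
    y.2.map (IsScalarTower.toAlgHom O (maxAbelianExt E Es) Es)
  refine mem_jacobson_integralClosure_of_coe (maxAbelianExt E Es) ?_ (h ⟨_, hy⟩)
  exact (congrArg (· - ((y : maxAbelianExt E Es) : Es)) (galoisAbEquiv_mk_apply σ y)).symm

variable {e : O ≃+* PowerSeries k} [IsGalois k ks] {j : ks →+* Es}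
  (hj : ∀ a, j (algebraMap k ks a) = algebraMap E Es (constantsEmbedding e a))

include hj in
/-- Inertia acts trivially on the maximal abelian extension of the field of constants. -/
theorem restrictionHom_mem_of_mem_inertiaAb {σ : Gal(Es/E)}
    (h : (QuotientGroup.mk σ : GaloisAb E Es) ∈ inertiaAb O Es) :
    restrictionHom j hj σ ∈ (commutator Gal(ks/k)).topologicalClosure := by
  rw [mk_mem_inertiaAb_iff] at h
  rw [mem_commutator_topologicalClosure_iff]
  intro x hx
  have hmem : ∀ x ∈ maxAbelianExt k ks, j x ∈ maxAbelianExt E Es := fun x hx =>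
    mem_maxAbelianExt_iff.2 fun τ hτ => by
      rw [restrictionHom_spec j hj]
      exact congrArg j (mem_maxAbelianExt_iff.1 hx _
        ((restrictionHom j hj).map_mem_commutator_topologicalClosure hτ))
  have hint : ∀ y : maxAbelianExt E Es, ∀ x : ks, (y : Es) = j x → IsIntegral O y := by
    intro y x hyx
    refine (isIntegral_algHom_iff (IsScalarTower.toAlgHom O (maxAbelianExt E Es) Es)
      (algebraMap (maxAbelianExt E Es) Es).injective).1 ?_
    change IsIntegral O (y : Es)
    rw [hyx]
    exact isIntegral_of_constants hj x
  let y : integralClosure O (maxAbelianExt E Es) := ⟨⟨j x, hmem x hx⟩, hint _ x rfl⟩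
  have hy := h y
  set d := galoisAbEquiv E Es (QuotientGroup.mk σ) • y - y with hd
  have hdval : ((d : maxAbelianExt E Es) : Es) = j (restrictionHom j hj σ x - x) := by
    rw [map_sub, ← restrictionHom_spec j hj]
    exact congrArg (· - j x) (galoisAbEquiv_mk_apply σ _)
  by_contra hne
  have hne' : restrictionHom j hj σ x - x ≠ 0 := sub_ne_zero.2 hne
  have hd0 : (d : maxAbelianExt E Es) ≠ 0 := by
    intro h0
    rw [h0] at hdval
    exact hne' (j.injective (by rw [← hdval, map_zero]; rfl))
  -- If `σ` moved `x`, then `d` would be a nonzero constant. Its inverse is also a constant, hence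
  -- integral, so `d` would be a unit in the Jacobson radical.
  have hinv : IsIntegral O (d : maxAbelianExt E Es)⁻¹ :=
    hint _ (restrictionHom j hj σ x - x)⁻¹ (by
      rw [map_inv₀, ← hdval]; rfl)
  have hunit : IsUnit d := IsUnit.of_mul_eq_one ⟨_, hinv⟩ (Subtype.ext (mul_inv_cancel₀ hd0))
  have := Ideal.mem_jacobson_bot.1 hy (-(hunit.unit⁻¹ : (integralClosure O (maxAbelianExt E Es))ˣ))
  rw [mul_neg, IsUnit.mul_val_inv, neg_add_cancel] at this
  exact not_isUnit_zero this

include hj in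
/-- The restriction map to the Galois group of the constants is the canonical one. -/
theorem isRestrictionToConstants_map_restrictionHom :
    IsRestrictionToConstants e (TopologicalAbelianization.map (restrictionHom j hj)) := by
  intro j' hj' σ τ
  obtain ⟨α, hα⟩ := exists_algEquiv_apply_eq (K := k) j' j fun a => (hj' a).trans (hj a).symm
  rw [TopologicalAbelianization.map_mk]
  set ρ := restrictionHom j hj σ with hρ
  -- Replacing `j` by `j'` conjugates the restriction by `α`, which is invisible in the
  -- abelianization.
  have h1 : (QuotientGroup.mk ρ : GaloisAb k ks) = QuotientGroup.mk τ ↔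
      (α * τ)⁻¹ * (ρ * α) ∈ (commutator Gal(ks/k)).topologicalClosure := by
    rw [← QuotientGroup.eq, QuotientGroup.mk_mul, QuotientGroup.mk_mul,
      mul_comm (α : GaloisAb k ks), mul_left_inj, eq_comm]
  rw [h1, mem_commutator_topologicalClosure_iff]
  refine forall₂_congr fun x _ => ?_
  rw [hα, hα, restrictionHom_spec j hj, j.injective.eq_iff, ← hρ, AlgEquiv.mul_apply]
  exact AlgEquiv.symm_apply_eq (α * τ)

end Inertia

/-! ### Assembly of the two splittings. -/

theorem proposition4 (p : ℕ) [Fact p.Prime]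
    (k : Type*) [Field k] [CharP k p]
    (ks : Type*) [Field ks] [Algebra k ks] [IsSepClosure k ks]
    (E : Type*) [Field E] (O : ValuationSubring E) (e : O ≃+* PowerSeries k)
    (Es : Type*) [Field Es] [Algebra E Es] [IsSepClosure E Es] :
    ∃ π : GaloisAb E Es →ₜ* GaloisAb k ks,
      IsRestrictionToConstants e π ∧
      (∃ φ : (inertiaAb O Es) × GaloisAb k ks ≃ₜ* GaloisAb E Es,
        (∀ x : inertiaAb O Es, φ (x, 1) = x) ∧
        (∀ z, π (φ z) = z.2)) ∧
      (∃ P : Subgroup (GaloisAb E Es),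
        IsProPSylow p P (inertiaAb O Es) ∧
        (∀ Q : Subgroup (GaloisAb E Es), IsProPSylow p Q (inertiaAb O Es) → Q = P) ∧
        ∃ Φ : P × (inertiaAb O Es ⧸ P.subgroupOf (inertiaAb O Es)) × GaloisAb k ks
            ≃ₜ* GaloisAb E Es,
          (∀ x : P, Φ (x, 1, 1) = x) ∧
          (∀ y : inertiaAb O Es, ∃ x : P, Φ (1, QuotientGroup.mk y, 1) = x * y) ∧
          (∀ z, π (Φ z) = z.2.2)) := by
  have : IsSepClosed ks := IsSepClosure.sep_closed k
  have : IsSepClosed Es := IsSepClosure.sep_closed E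
  have : CharP ks p := charP_of_injective_algebraMap (algebraMap k _).injective p
  obtain ⟨ι, hι⟩ := exists_sepClosure_to_hahn ks Es e
  obtain ⟨j, hjk, hj⟩ := exists_constants_embedding (k := k) hι
  let r : Gal(Es/E) →ₜ* Gal(ks/k) := restrictionHom j hjk
  let s : Gal(ks/k) →ₜ* Gal(Es/E) := constantsLift hι p
  have hrs : ∀ τ, r (s τ) = τ := fun τ => by
    ext x
    apply j.injective
    rw [← restrictionHom_spec j hjk, constantsLift_apply hι p hj]
  let π : GaloisAb E Es →ₜ* GaloisAb k ks := TopologicalAbelianization.map r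
  let sab : GaloisAb k ks →ₜ* GaloisAb E Es := TopologicalAbelianization.map s
  have hπs : ∀ z, π (sab z) = z := fun z => by
    obtain ⟨τ, rfl⟩ := QuotientGroup.mk_surjective z
    exact congrArg _ (hrs τ)
  have hker : ∀ g, g ∈ inertiaAb O Es ↔ π g = 1 := by
    intro g
    obtain ⟨σ, rfl⟩ := QuotientGroup.mk_surjective g
    refine Iff.trans ?_ (QuotientGroup.eq_one_iff (r σ)).symm
    refine ⟨restrictionHom_mem_of_mem_inertiaAb hjk, fun hσ => ?_⟩
    -- Since `r σ` is trivial in the abelianization, so is `s (r σ)`; dividing by it keeps the class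
    -- of `σ` and makes the representative fix all of `ks`, not only `k^ab`.
    have hc : s (r σ) ∈ (commutator Gal(Es/E)).topologicalClosure :=
      s.map_mem_commutator_topologicalClosure hσ
    have hr : r (σ * (s (r σ))⁻¹) = 1 := by rw [map_mul, map_inv, hrs, mul_inv_cancel]
    have hmk : (QuotientGroup.mk σ : GaloisAb E Es) = QuotientGroup.mk (σ * (s (r σ))⁻¹) := by
      rw [QuotientGroup.mk_mul, (QuotientGroup.eq_one_iff _).2 (inv_mem hc), mul_one]
    rw [hmk]
    refine mk_mem_inertiaAb_of_forall (smul_sub_mem_jacobson hι p hjk hj fun x => ?_)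
    rw [restrictionHom_spec j hjk]
    exact congrArg (fun τ : Gal(ks/k) => j (τ x)) hr
  have hI : IsClosed (inertiaAb O Es : Set (GaloisAb E Es)) := by
    have : (inertiaAb O Es : Set (GaloisAb E Es)) = π ⁻¹' {1} := by
      ext g; exact hker g
    rw [this]
    exact isClosed_singleton.preimage π.continuous_toFun
  have : CompactSpace (inertiaAb O Es) := isCompact_iff_compactSpace.1 hI.isCompact
  have : TotallyDisconnectedSpace (GaloisAb E Es) :=
    QuotientGroup.totallyDisconnectedSpace_of_isClosed _
  let f : inertiaAb O Es × GaloisAb k ks →* GaloisAb E Es :=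
    (inertiaAb O Es).subtype.coprod sab.toMonoidHom
  have hf : ∀ z, f z = z.1 * sab z.2 := fun _ => rfl
  have hπf : ∀ z, π (f z) = z.2 := fun z => by
    rw [hf, map_mul, (hker _).1 z.1.2, one_mul, hπs]
  have hfc : Continuous f :=
    (continuous_subtype_val.comp continuous_fst).mul (sab.continuous_toFun.comp continuous_snd)
  have hfb : Function.Bijective f := by
    constructor
    · rw [injective_iff_map_eq_one]
      intro z hz
      have h2 : z.2 = 1 := by rw [← hπf z, hz, map_one]
      rw [hf, h2, map_one, mul_one] at hz
      exact Prod.ext (Subtype.ext hz) h2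
    · intro g
      refine ⟨(⟨g * (sab (π g))⁻¹, (hker _).2 ?_⟩, π g), ?_⟩
      · rw [map_mul, map_inv, hπs, mul_inv_cancel]
      · rw [hf]; exact inv_mul_cancel_right _ _
  let φ : inertiaAb O Es × GaloisAb k ks ≃ₜ* GaloisAb E Es :=
    ContinuousMulEquiv.ofBijectiveCompact f hfc hfb
  have hφ : ∀ x : inertiaAb O Es, φ (x, 1) = x := fun x => by
    change f (x, 1) = x
    rw [hf, map_one, mul_one]
  obtain ⟨P, hP, hPu, Φ, h1, h2, h3⟩ := exists_proPSylow_splitting p hI φ hφ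
  refine ⟨π, isRestrictionToConstants_map_restrictionHom hjk, ⟨φ, hφ, hπf⟩, P, hP, hPu, Φ, h1, h2,
    fun z => ?_⟩
  rw [← h3 z, ← hπf]
  exact congrArg π (φ.apply_symm_apply _).symm
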